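/- Let $\mathfrak P=(P_{n,\pm})_{n\ge 0}$ be a shaded planar algebra over $\mathbb C$ (for instance a subfactor planar algebra), fix a shading $\varepsilon\in\{+,-\}$ and an integer $k\ge 0$, and consider the graded vector space $\mathrm{Gr}_k=\bigoplus_{n\ge 0}P_{n,k}$, where $P_{n,k}=P_{n+k,\varepsilon}$. The $2(n+k)$ boundary points of an element of $P_{n,k}$ are drawn as $2n$ points on the top, $k$ on the left side and $k$ on the right side of a box whose distinguished boundary interval is at the top left corner. For $a\in P_{m,k}$, $b\in P_{n,k}$ and $0\le i\le\min(2m,2n)$ let $a\cdot_i b\in P_{m+n-i,k}$ be the result of placing $a$ to the left of $b$, joining the $k$ strings on the right of $a$ to the $k$ strings on the left of $b$ by parallel strings, and joining the last $i$ top strings of $a$ to the first $i$ top strings of $b$ by $i$ parallel strings. Let $\bullet$ (the juxtaposition product of Guionnet–Jones–Shlyakhtenko) and $\star$ (the orthogonal product) be the bilinear products on $\mathrm{Gr}_k$ with $$a\bullet b=a\cdot_0 b,\qquad a\star b=\sum_{i=0}^{\min(2m,2n)}a\cdot_i b\qquad(a\in P_{m,k},\ b\in P_{n,k}).$$ A Temperley–Lieb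 diagram here is a loopless non-crossing perfect matching of points on the bottom and top sides of a rectangle. It is *epi* if every point on the top is joined to a point on the bottom. An epi diagram is *non-nested* if no turn-back (a string joining two bottom points) encloses another turn-back. A diagram with $2i$ bottom points and $2j$ top points acts as a linear map $P_{i,k}\to P_{j,k}$ by gluing its bottom to the top strings. Let $X:\mathrm{Gr}_k\to \mathrm{Gr}_k$ be the linear map whose component $P_{i,k}\to P_{j,k}$ is the sum of all epi diagrams from $2i$ to $2j$ points, and let $Y:\mathrm{Gr}_k\to\mathrm{Gr}_k$ be the linear map whose component $P_{i,k}\to P_{j,k}$ is $(-1)^{i-j}$ times the sum of all non-nested epi diagrams from $2i$ to $2j$ points (there are none if $j>i$). Then $$XY=1=YX,\qquad\text{and}\qquad X(a\bullet b)=X(a)\star X(b)\quad\text{for all }a,b\in\mathrm{Gr}_k .$$ -/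

import Mathlib

open scoped DirectSum

universe u

namespace PlanarAlg

/-! ### Labelled shaded planar tangles

A shaded planar tangle is drawn in a rectangle with all of its `2 * n` outer boundary points on the
top edge, numbered from left to right; the distinguished boundary interval runs from the last point,
around the bottom, to the first one.  Every input box is likewise drawn with all of its boundary
points on its top edge, the distinguished interval running around its bottom.  In general position
with respect to height, such a picture is read from the bottom to the top as a sequence of layers,
each of which adds a local minimum of a string, a local maximum of a string, or an input box.
Shadings are Booleans (`true` for shaded); crossing a string flips the shading.
Input boxes carry labels in a family `V n ε` of spaces indexed by half the number of boundary
points and by the shading of the distinguished interval. -/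

/-- The elementary pieces of a labelled tangle. -/
inductive Shape (V : ℕ → Bool → Type u) : Type u
  | cup : Shape V
  | cap : Shape V
  | box (n : ℕ) (ε : Bool) (a : V n ε) : Shape V

/-- Number of strings entering a piece from below. -/
def Shape.dom {V : ℕ → Bool → Type u} : Shape V → ℕ
  | .cup => 0
  | .cap => 2
  | .box _ _ _ => 0

/-- Number of strings leaving a piece at its top. -/
def Shape.cod {V : ℕ → Bool → Type u} : Shape V → ℕ
  | .cup => 2
  | .cap => 0
  | .box n _ _ => 2 * n

/-- A layer: one elementary piece having exactly `pos` vertical strings on its left. -/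
structure Layer (V : ℕ → Bool → Type u) : Type u where
  pos : ℕ
  shape : Shape V

variable {V : ℕ → Bool → Type u}

def cupAt (i : ℕ) : Layer V := ⟨i, .cup⟩

def capAt (i : ℕ) : Layer V := ⟨i, .cap⟩

def boxAt (i : ℕ) {n : ℕ} {ε : Bool} (a : V n ε) : Layer V := ⟨i, .box n ε a⟩

/-- Put `i` vertical strings to the left of a layer. -/
def Layer.shift (i : ℕ) (l : Layer V) : Layer V := ⟨i + l.pos, l.shape⟩

/-- Shading of the region having `i` strings to its left, if the leftmost region has shading `ε`. -/
def regionShading (ε : Bool) (i : ℕ) : Bool := if Even i then ε else !ε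

/-- The shading condition on a piece with `i` strings on its left: the distinguished interval of an
input box must touch a region of the shading prescribed for that box. -/
def Shape.ShadingOK (ε : Bool) (i : ℕ) : Shape V → Prop
  | .cup => True
  | .cap => True
  | .box _ η _ => η = regionShading ε i

/-- `IsTangleWord ε N w M`: the layers `w`, read from bottom to top, lead from `N` strings to `M`
strings, where the leftmost region has shading `ε`. -/
def IsTangleWord (ε : Bool) : ℕ → List (Layer V) → ℕ → Prop
  | N, [], M => N = M
  | N, l :: w, M =>
      l.pos + l.shape.dom ≤ N ∧ l.shape.ShadingOK ε l.pos ∧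
        IsTangleWord ε (N - l.shape.dom + l.shape.cod) w M

/-- Labelled shaded planar tangles (in general position) with `2 * n` outer boundary points and
distinguished outer interval of shading `ε`. -/
def Tangle (V : ℕ → Bool → Type u) (n : ℕ) (ε : Bool) : Type u :=
  {w : List (Layer V) // IsTangleWord ε 0 w (2 * n)}

/-- The elementary planar isotopies between pictures in general position: exchange of the heights of
two pieces lying beside each other, straightening of a zigzag in a string, and a full turn of an
input box. -/
inductive Move : List (Layer V) → List (Layer V) → Prop
  | interchange (s t : Shape V) (i d : ℕ) :
      Move [⟨i, s⟩, ⟨i + s.cod + d, t⟩] [⟨i + s.dom + d, t⟩, ⟨i, s⟩]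
  | zigzag_left (i : ℕ) : Move [cupAt i, capAt (i + 1)] []
  | zigzag_right (i : ℕ) : Move [cupAt (i + 1), capAt i] []
  | full_turn (i : ℕ) {n : ℕ} {ε : Bool} (a : V n ε) :
      Move
        ((List.range (2 * n)).map (fun j => cupAt (i + j)) ++ [boxAt (i + 2 * n) a] ++
          (List.range (2 * n)).reverse.map (fun j => capAt (i + j)))
        [boxAt i a]

/-- Two tangles differ by one elementary isotopy, performed somewhere in the picture. -/
def IsotopyStep {n : ℕ} {ε : Bool} (S T : Tangle V n ε) : Prop :=
  ∃ u₁ u₂ x y : List (Layer V), Move x y ∧ S.1 = u₁ ++ x ++ u₂ ∧ T.1 = u₁ ++ y ++ u₂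

/-- A shaded planar algebra over `ℂ` on the spaces `V n ε`: labelled shaded planar tangles with
labels in these spaces are evaluated to elements of these spaces, linearly in each label, up to
planar isotopy, compatibly with the gluing of tangles into input boxes, and such that the tangle
consisting of one box with strings straight to the outer boundary acts as the identity. -/
structure PlanarAlgebra (V : ℕ → Bool → Type u)
    [∀ n ε, AddCommGroup (V n ε)] [∀ n ε, Module ℂ (V n ε)] : Type u where
  eval : ∀ {n : ℕ} {ε : Bool}, Tangle V n ε → V n ε
  eval_add : ∀ {n m : ℕ} {ε η : Bool} (w₁ w₂ : List (Layer V)) (i : ℕ) (a b : V m η)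
    (h : IsTangleWord ε 0 (w₁ ++ boxAt i (a + b) :: w₂) (2 * n))
    (ha : IsTangleWord ε 0 (w₁ ++ boxAt i a :: w₂) (2 * n))
    (hb : IsTangleWord ε 0 (w₁ ++ boxAt i b :: w₂) (2 * n)),
    eval ⟨w₁ ++ boxAt i (a + b) :: w₂, h⟩
      = eval ⟨w₁ ++ boxAt i a :: w₂, ha⟩ + eval ⟨w₁ ++ boxAt i b :: w₂, hb⟩
  eval_smul : ∀ {n m : ℕ} {ε η : Bool} (w₁ w₂ : List (Layer V)) (i : ℕ) (c : ℂ) (a : V m η)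
    (h : IsTangleWord ε 0 (w₁ ++ boxAt i (c • a) :: w₂) (2 * n))
    (ha : IsTangleWord ε 0 (w₁ ++ boxAt i a :: w₂) (2 * n)),
    eval ⟨w₁ ++ boxAt i (c • a) :: w₂, h⟩ = c • eval ⟨w₁ ++ boxAt i a :: w₂, ha⟩
  eval_isotopy : ∀ {n : ℕ} {ε : Bool} (S T : Tangle V n ε), IsotopyStep S T → eval S = eval T
  eval_box : ∀ {n : ℕ} {ε : Bool} (a : V n ε)
    (h : IsTangleWord ε 0 [boxAt 0 a] (2 * n)), eval ⟨[boxAt 0 a], h⟩ = a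
  eval_glue : ∀ {n m : ℕ} {ε η : Bool} (w₁ w₂ : List (Layer V)) (i : ℕ) (S : Tangle V m η)
    (h : IsTangleWord ε 0 (w₁ ++ boxAt i (eval S) :: w₂) (2 * n))
    (h' : IsTangleWord ε 0 (w₁ ++ S.1.map (Layer.shift i) ++ w₂) (2 * n)),
    eval ⟨w₁ ++ boxAt i (eval S) :: w₂, h⟩ = eval ⟨w₁ ++ S.1.map (Layer.shift i) ++ w₂, h'⟩

theorem isTangleWord_relabel {ε : Bool} {m : ℕ} {η : Bool} (a b : V m η) (w₁ w₂ : List (Layer V))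
    (i : ℕ) (N M : ℕ) (h : IsTangleWord ε N (w₁ ++ boxAt i a :: w₂) M) :
    IsTangleWord ε N (w₁ ++ boxAt i b :: w₂) M := by
  induction w₁ generalizing N with
  | nil => exact h
  | cons l w ih => exact ⟨h.1, h.2.1, ih _ h.2.2⟩

section Evaluation

variable [∀ n ε, AddCommGroup (V n ε)] [∀ n ε, Module ℂ (V n ε)]

open Classical in
/-- Evaluation of a list of layers (`0` if it is not a tangle with `2 * n` outer points). -/
noncomputable def PlanarAlgebra.evalWord (P : PlanarAlgebra V) (n : ℕ) (ε : Bool)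
    (w : List (Layer V)) : V n ε :=
  if h : IsTangleWord ε 0 w (2 * n) then P.eval ⟨w, h⟩ else 0

theorem PlanarAlgebra.evalWord_add (P : PlanarAlgebra V) (n : ℕ) (ε : Bool) {m : ℕ} {η : Bool}
    (w₁ w₂ : List (Layer V)) (i : ℕ) (a b : V m η) :
    P.evalWord n ε (w₁ ++ boxAt i (a + b) :: w₂)
      = P.evalWord n ε (w₁ ++ boxAt i a :: w₂) + P.evalWord n ε (w₁ ++ boxAt i b :: w₂) := by
  by_cases h : IsTangleWord ε 0 (w₁ ++ boxAt i (a + b) :: w₂) (2 * n)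
  · have ha := isTangleWord_relabel (a + b) a w₁ w₂ i 0 _ h
    have hb := isTangleWord_relabel (a + b) b w₁ w₂ i 0 _ h
    simp only [PlanarAlgebra.evalWord, dif_pos h, dif_pos ha, dif_pos hb]
    exact P.eval_add w₁ w₂ i a b h ha hb
  · have ha : ¬ IsTangleWord ε 0 (w₁ ++ boxAt i a :: w₂) (2 * n) :=
      fun h' => h (isTangleWord_relabel _ _ w₁ w₂ i 0 _ h')
    have hb : ¬ IsTangleWord ε 0 (w₁ ++ boxAt i b :: w₂) (2 * n) :=
      fun h' => h (isTangleWord_relabel _ _ w₁ w₂ i 0 _ h')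
    simp only [PlanarAlgebra.evalWord, dif_neg h, dif_neg ha, dif_neg hb, add_zero]

theorem PlanarAlgebra.evalWord_smul (P : PlanarAlgebra V) (n : ℕ) (ε : Bool) {m : ℕ} {η : Bool}
    (w₁ w₂ : List (Layer V)) (i : ℕ) (c : ℂ) (a : V m η) :
    P.evalWord n ε (w₁ ++ boxAt i (c • a) :: w₂)
      = c • P.evalWord n ε (w₁ ++ boxAt i a :: w₂) := by
  by_cases h : IsTangleWord ε 0 (w₁ ++ boxAt i (c • a) :: w₂) (2 * n)
  · have ha := isTangleWord_relabel (c • a) a w₁ w₂ i 0 _ h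
    simp only [PlanarAlgebra.evalWord, dif_pos h, dif_pos ha]
    exact P.eval_smul w₁ w₂ i c a h ha
  · have ha : ¬ IsTangleWord ε 0 (w₁ ++ boxAt i a :: w₂) (2 * n) :=
      fun h' => h (isTangleWord_relabel _ _ w₁ w₂ i 0 _ h')
    simp only [PlanarAlgebra.evalWord, dif_neg h, dif_neg ha, smul_zero]

/-- A tangle with one labelled box, as a linear map in the label. -/
noncomputable def PlanarAlgebra.linearAction (P : PlanarAlgebra V) (n : ℕ) (ε : Bool) {m : ℕ}
    {η : Bool} (w₁ : List (Layer V)) (i : ℕ) (w₂ : List (Layer V)) : V m η →ₗ[ℂ] V n ε where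
  toFun a := P.evalWord n ε (w₁ ++ boxAt i a :: w₂)
  map_add' a b := P.evalWord_add n ε w₁ w₂ i a b
  map_smul' c a := P.evalWord_smul n ε w₁ w₂ i c a

end Evaluation

/-! ### Temperley–Lieb diagrams -/

/-- Position of a boundary point of a rectangle with `n` points on the bottom and `m` on the top
(both numbered from left to right), going around the boundary from the bottom left corner through
the bottom right, top right and top left corners. -/
def rectPos {n m : ℕ} : Fin n ⊕ Fin m → ℕ
  | Sum.inl i => i
  | Sum.inr j => n + (m - 1 - j)

/-- Loopless Temperley–Lieb diagrams with `n` points on the bottom and `m` points on the top of a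
rectangle: perfect matchings (`f x` is the point joined to `x`) of these points without crossings. -/
def TLDiagram (n m : ℕ) : Type :=
  {f : Fin n ⊕ Fin m → Fin n ⊕ Fin m //
    (∀ x, f (f x) = x) ∧ (∀ x, f x ≠ x) ∧
      ∀ x y, ¬ (rectPos x < rectPos y ∧ rectPos y < rectPos (f x) ∧
        rectPos (f x) < rectPos (f y))}

instance (n m : ℕ) : Fintype (TLDiagram n m) := by
  unfold TLDiagram; infer_instance

/-- Each point on the top is joined to the bottom. -/
def TLDiagram.IsEpi {n m : ℕ} (D : TLDiagram n m) : Prop :=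
  ∀ j : Fin m, ∃ i : Fin n, D.1 (Sum.inr j) = Sum.inl i

/-- No turn-back on the bottom encloses another turn-back. -/
def TLDiagram.NonNested {n m : ℕ} (D : TLDiagram n m) : Prop :=
  ∀ p q p' q' : Fin n, D.1 (Sum.inl p) = Sum.inl q → D.1 (Sum.inl p') = Sum.inl q' →
    ¬ (p < p' ∧ p' < q' ∧ q' < q)

instance {n m : ℕ} (D : TLDiagram n m) : Decidable D.IsEpi := by
  unfold TLDiagram.IsEpi; infer_instance

instance {n m : ℕ} (D : TLDiagram n m) : Decidable D.NonNested := by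
  unfold TLDiagram.NonNested; infer_instance

/-- For turn-backs on one side of a rectangle with `n` points, `g q = some p` meaning that `q` is
joined to the point `p` of the same side: the turn-backs in the order of their right ends `q`, each
given by the number of strings still present to its left once the preceding turn-backs are closed
(`p` minus two for each turn-back whose right end lies before the left end `p`). -/
def turnBacks {n : ℕ} (g : Fin n → Option (Fin n)) : List ℕ :=
  (List.finRange n).filterMap fun q =>
    (g q).bind fun p =>
      if p < q then
        some ((p : ℕ) - 2 * (Finset.univ.filter fun r : Fin n => r < p ∧ ∃ t, g r = some t ∧ t < r).card)
      else none

def TLDiagram.bottom {n m : ℕ} (D : TLDiagram n m) (q : Fin n) : Option (Fin n) :=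
  (D.1 (Sum.inl q)).getLeft?

def TLDiagram.top {n m : ℕ} (D : TLDiagram n m) (q : Fin m) : Option (Fin m) :=
  (D.1 (Sum.inr q)).getRight?

/-- A Temperley–Lieb diagram as layers, from bottom to top: first its turn-backs on the bottom, as
caps, then its turn-backs on the top, as cups. -/
def TLDiagram.layers {n m : ℕ} (D : TLDiagram n m) : List (Layer V) :=
  (turnBacks D.bottom).map capAt ++ (turnBacks D.top).reverse.map cupAt

/-! ### The graded space, its two products, and the change of basis -/

section Graded

variable [∀ n ε, AddCommGroup (V n ε)] [∀ n ε, Module ℂ (V n ε)]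

/-- The graded space `⨁ₙ P_{n,k}`, where `P_{n,k} = P_{n+k}`.  The `2 * (n + k)` boundary points of an
element of `P_{n,k}`, in clockwise order from the distinguished interval (at the top left corner of
its box), are the `2 * n` points on the top from left to right, the `k` points on the right side from
top to bottom, and the `k` points on the left side from bottom to top. -/
abbrev Graded (V : ℕ → Bool → Type u) [∀ n ε, AddCommGroup (V n ε)] (ε : Bool) (k : ℕ) : Type u :=
  ⨁ n : ℕ, V (n + k) ε

/-- `count` nested caps joining the `count` strings to the left of the gap after the first `left`
strings with the `count` strings to the right of this gap, from the innermost one outwards. -/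
def nestedCaps (left count : ℕ) : List (Layer V) :=
  (List.range count).map fun j => capAt (left - 1 - j)

/-- The labelled tangle that places `a ∈ P_{m,k}` to the left of `b ∈ P_{n,k}`, joins the `k` strings
on the right of `a` to the `k` strings on the left of `b`, and joins the last `i` top strings of `a`
to the first `i` top strings of `b`.  After both boxes are placed, the strings are from left to right:
`2 * m` (top of `a`), `2 * n` (top of `b`), `k` (right of `b`), `k` (left of `b`), `k` (right of `a`),
`k` (left of `a`). -/
def productWord {m n k : ℕ} {ε : Bool} (i : ℕ) (a : V (m + k) ε) (b : V (n + k) ε) :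
    List (Layer V) :=
  [boxAt 0 a, boxAt (2 * m) b] ++ nestedCaps (2 * m + 2 * n + 2 * k) k ++ nestedCaps (2 * m) i

/-- The bilinear map `P_{m,k} × P_{n,k} → P_{m+n-i,k}` given by the preceding tangle. -/
noncomputable def PlanarAlgebra.contract (P : PlanarAlgebra V) (ε : Bool) (k m n i : ℕ) :
    V (m + k) ε →ₗ[ℂ] V (n + k) ε →ₗ[ℂ] V (m + n - i + k) ε :=
  LinearMap.mk₂ ℂ (fun a b => P.evalWord (m + n - i + k) ε (productWord i a b))
    (fun a a' _ => P.evalWord_add _ ε [] _ 0 a a')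
    (fun c a _ => P.evalWord_smul _ ε [] _ 0 c a)
    (fun a b b' => P.evalWord_add _ ε [boxAt 0 a] _ (2 * m) b b')
    (fun c a b => P.evalWord_smul _ ε [boxAt 0 a] _ (2 * m) c b)

/-- Bilinear extension of products of homogeneous elements to the graded space. -/
noncomputable def bilinearExtension {ε : Bool} {k : ℕ}
    (B : ∀ m n : ℕ, V (m + k) ε →ₗ[ℂ] V (n + k) ε →ₗ[ℂ] Graded V ε k) :
    Graded V ε k →ₗ[ℂ] Graded V ε k →ₗ[ℂ] Graded V ε k :=
  DirectSum.toModule ℂ ℕ _ fun m =>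
    (DirectSum.toModule ℂ ℕ _ fun n => (B m n).flip).flip

/-- The juxtaposition product `a • b`. -/
noncomputable def PlanarAlgebra.juxt (P : PlanarAlgebra V) (ε : Bool) (k : ℕ) :
    Graded V ε k →ₗ[ℂ] Graded V ε k →ₗ[ℂ] Graded V ε k :=
  bilinearExtension fun m n =>
    (P.contract ε k m n 0).compr₂
      (DirectSum.lof ℂ ℕ (fun r => V (r + k) ε) (m + n))

/-- The orthogonal product `a ⋆ b`: for `a ∈ P_{m,k}`, `b ∈ P_{n,k}`, the sum over
`0 ≤ i ≤ min (2m) (2n)` of the contractions along `i` top strings. -/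
noncomputable def PlanarAlgebra.orthProd (P : PlanarAlgebra V) (ε : Bool) (k : ℕ) :
    Graded V ε k →ₗ[ℂ] Graded V ε k →ₗ[ℂ] Graded V ε k :=
  bilinearExtension fun m n =>
    ∑ i ∈ Finset.range (min (2 * m) (2 * n) + 1),
      (P.contract ε k m n i).compr₂
        (DirectSum.lof ℂ ℕ (fun r => V (r + k) ε) (m + n - i))

/-- A Temperley–Lieb diagram with `2 * i` bottom and `2 * j` top points, glued to the top strings, as
a linear map `P_{i,k} → P_{j,k}`. -/
noncomputable def PlanarAlgebra.tlAction (P : PlanarAlgebra V) (ε : Bool) (k : ℕ) {i j : ℕ}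
    (D : TLDiagram (2 * i) (2 * j)) : V (i + k) ε →ₗ[ℂ] V (j + k) ε :=
  P.linearAction (j + k) ε [] 0 D.layers

/-- The `j, i` block of `X`: the sum of all epi diagrams. -/
noncomputable def PlanarAlgebra.xBlock (P : PlanarAlgebra V) (ε : Bool) (k : ℕ) (j i : ℕ) :
    V (i + k) ε →ₗ[ℂ] V (j + k) ε :=
  ∑ D ∈ Finset.univ.filter (fun D : TLDiagram (2 * i) (2 * j) => D.IsEpi), P.tlAction ε k D

/-- The `j, i` block of `Y`: the sum of all non-nested epi diagrams, with sign `(-1) ^ (i - j)`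
(there is none if `i < j`). -/
noncomputable def PlanarAlgebra.yBlock (P : PlanarAlgebra V) (ε : Bool) (k : ℕ) (j i : ℕ) :
    V (i + k) ε →ₗ[ℂ] V (j + k) ε :=
  (-1 : ℂ) ^ (i - j) •
    ∑ D ∈ Finset.univ.filter (fun D : TLDiagram (2 * i) (2 * j) => D.IsEpi ∧ D.NonNested),
      P.tlAction ε k D

/-- There are no epi diagrams with more points on the top than on the bottom. -/
theorem TLDiagram.le_of_isEpi {n m : ℕ} (D : TLDiagram n m) (h : D.IsEpi) : m ≤ n := by
  choose g hg using h
  have hinj : Function.Injective g := by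
    intro j j' hjj
    have h1 : D.1 (Sum.inr j) = D.1 (Sum.inr j') := by rw [hg, hg, hjj]
    have h2 := congrArg D.1 h1
    rw [D.2.1, D.2.1] at h2
    exact Sum.inr.inj h2
  simpa using Fintype.card_le_of_injective g hinj

/-- The linear endomorphism of the graded space with given blocks; the blocks `B j i` with `i < j`
are not used (in the two applications below they vanish). -/
noncomputable def upperTriangular {ε : Bool} {k : ℕ}
    (B : ∀ j i : ℕ, V (i + k) ε →ₗ[ℂ] V (j + k) ε) : Graded V ε k →ₗ[ℂ] Graded V ε k :=
  DirectSum.toModule ℂ ℕ _ fun i =>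
    ∑ j ∈ Finset.range (i + 1), DirectSum.lof ℂ ℕ (fun r => V (r + k) ε) j ∘ₗ B j i

/-- `X`, the sum of all epi diagrams. -/
noncomputable def PlanarAlgebra.X (P : PlanarAlgebra V) (ε : Bool) (k : ℕ) :
    Graded V ε k →ₗ[ℂ] Graded V ε k :=
  upperTriangular (P.xBlock ε k)

/-- `Y`, the signed sum of all non-nested epi diagrams. -/
noncomputable def PlanarAlgebra.Y (P : PlanarAlgebra V) (ε : Bool) (k : ℕ) :
    Graded V ε k →ₗ[ℂ] Graded V ε k :=
  upperTriangular (P.yBlock ε k)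

theorem PlanarAlgebra.xBlock_eq_zero (P : PlanarAlgebra V) (ε : Bool) (k : ℕ) {j i : ℕ}
    (h : i < j) : P.xBlock ε k j i = 0 := by
  unfold PlanarAlgebra.xBlock
  rw [Finset.filter_false_of_mem, Finset.sum_empty]
  intro D _ hD
  have := D.le_of_isEpi hD
  omega

theorem PlanarAlgebra.yBlock_eq_zero (P : PlanarAlgebra V) (ε : Bool) (k : ℕ) {j i : ℕ}
    (h : i < j) : P.yBlock ε k j i = 0 := by
  unfold PlanarAlgebra.yBlock
  rw [Finset.filter_false_of_mem, Finset.sum_empty, smul_zero]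
  intro D _ hD
  have := D.le_of_isEpi hD.1
  omega

end Graded

end PlanarAlg

/-! Number top strings from `0`, and let `c_p` join strings `p` and `p + 1`, with value zero when
these do not both exist. Caps on disjoint strings may be drawn in either order, so `c_q c_p = c_p
c_{q+2}` for `p ≤ q` (`capOp_mul_capOp`). Everything rests on the factorisation `X = (1 + c_0)(1 +
c_1)(1 + c_2)⋯`, a finite product in each degree (`X_eq_capTail`).

To prove it, let `F_s` be the sum of the epi diagrams whose turn-backs all have right end at least
`s`. If `s + 1` is a right end of such a diagram for `F_{s+1}`, planarity forces its partner to be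
`s`, and deleting this arc gives `F_{s+1} = F_{s+2} + F_s c_s`. With `T_s = (1 + c_s)(1 + c_{s+1})⋯`
and `R_s = 1 + c_{s-1} + c_{s-2} c_{s-1} + ⋯ + c_0 ⋯ c_{s-1}`, the products `R_s T_s` satisfy the
same recursion and boundary conditions, and `R_0 T_0 = T_0`.

For the signed sums `G_s` of non-nested diagrams, deleting the arc leaves no right end at `s`
either, since such a turn-back would have enclosed the arc. Hence `G_{s+2} = G_{s+1}(1 + c_s)`,
which telescopes to `Y X = 1` (`Y_mul_capTail`). Each `c_p` lowers degree, so `X` is unitriangular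
and therefore surjective (`capTail_surjective`); thus `X Y = 1` too.

For products, the factors of `X` are applied to a juxtaposition from the right. Those beyond the
strings of `x` build `X y`. The remaining ones either act inside `x` or, at the seam, join one more
string of `x` to one of `y`. The interpolation `rightCapped` records this: `(1 + c_s)` carries stage
`s + 1` to stage `s` while moving onto `x` (`one_add_capOp_rightCapped`), and the last stage is the
orthogonal product. -/

namespace PlanarAlg

variable {V : ℕ → Bool → Type u}

/-! ### Words of layers -/

theorem regionShading_add_two (ε : Bool) (i : ℕ) : regionShading ε (i + 2) = regionShading ε i := by
  simp [regionShading, Nat.even_add]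

theorem regionShading_two_mul (ε : Bool) (i : ℕ) : regionShading ε (2 * i) = ε := by
  simp [regionShading]

theorem regionShading_add (ε : Bool) (i j : ℕ) :
    regionShading (regionShading ε i) j = regionShading ε (i + j) := by
  by_cases hi : Even i <;> by_cases hj : Even j <;> simp [regionShading, Nat.even_add, hi, hj]

theorem regionShading_add_two_mul (ε : Bool) (i d : ℕ) :
    regionShading ε (i + 2 * d) = regionShading ε i := by
  induction d with
  | zero => rfl
  | succ d ih => rw [Nat.mul_succ, ← Nat.add_assoc, regionShading_add_two, ih]

theorem Shape.exists_dom (s : Shape V) : ∃ d, s.dom = 2 * d := by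
  cases s
  exacts [⟨0, rfl⟩, ⟨1, rfl⟩, ⟨0, rfl⟩]

theorem Shape.exists_cod (s : Shape V) : ∃ d, s.cod = 2 * d := by
  cases s with
  | cup => exact ⟨1, rfl⟩
  | cap => exact ⟨0, rfl⟩
  | box n => exact ⟨n, rfl⟩

theorem Shape.shadingOK_congr {ε η : Bool} {i j : ℕ} (h : regionShading ε i = regionShading η j)
    (s : Shape V) : s.ShadingOK ε i ↔ s.ShadingOK η j := by
  cases s <;> simp [Shape.ShadingOK, h]

theorem isTangleWord_append_congr {ε : Bool} {x y : List (Layer V)} {M : ℕ}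
    (h : ∀ N, IsTangleWord ε N x M ↔ IsTangleWord ε N y M) (w : List (Layer V)) (N : ℕ) :
    IsTangleWord ε N (w ++ x) M ↔ IsTangleWord ε N (w ++ y) M := by
  induction w generalizing N with
  | nil => exact h N
  | cons l w ih => exact and_congr Iff.rfl (and_congr Iff.rfl (ih _))

/-- Every piece has an even number of strings below and above it, so moving a box past it does not
change the shading seen by the box. An equivalence is needed because `evalWord` is zero on words
that are not tangles. -/
theorem isTangleWord_interchange {ε : Bool} (s t : Shape V) (i d : ℕ) (w₁ w₂ : List (Layer V))
    (N M : ℕ) :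
    IsTangleWord ε N (w₁ ++ [⟨i, s⟩, ⟨i + s.cod + d, t⟩] ++ w₂) M ↔
      IsTangleWord ε N (w₁ ++ [⟨i + s.dom + d, t⟩, ⟨i, s⟩] ++ w₂) M := by
  rw [List.append_assoc, List.append_assoc]
  refine isTangleWord_append_congr (fun N => ?_) _ _
  have ht : t.ShadingOK ε (i + s.cod + d) ↔ t.ShadingOK ε (i + s.dom + d) := by
    apply Shape.shadingOK_congr
    obtain ⟨c, hc⟩ := s.exists_cod
    obtain ⟨e, he⟩ := s.exists_dom
    rw [hc, he, Nat.add_right_comm, regionShading_add_two_mul, Nat.add_right_comm,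
      regionShading_add_two_mul]
  simp only [List.cons_append, List.nil_append, IsTangleWord, ht]
  constructor
  · rintro ⟨h1, h2, h3, h4, h5⟩
    refine ⟨by omega, h4, by omega, h2, ?_⟩
    convert h5 using 1
    omega
  · rintro ⟨h1, h2, h3, h4, h5⟩
    refine ⟨by omega, h4, by omega, h2, ?_⟩
    convert h5 using 1
    omega

theorem isTangleWord_shift {ε : Bool} (i d : ℕ) (S w : List (Layer V)) (N M K : ℕ)
    (hS : IsTangleWord (regionShading ε i) N S M) :
    IsTangleWord ε (i + N + d) (S.map (Layer.shift i) ++ w) K ↔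
      IsTangleWord ε (i + M + d) w K := by
  induction S generalizing N with
  | nil => cases (show N = M from hS); rfl
  | cons l S ih =>
    obtain ⟨h1, h2, h3⟩ := hS
    rw [← ih _ h3]
    have h4 : l.shape.ShadingOK ε (i + l.pos) :=
      (Shape.shadingOK_congr (regionShading_add ε i l.pos) _).1 h2
    have h5 : i + N + d - l.shape.dom + l.shape.cod
        = i + (N - l.shape.dom + l.shape.cod) + d := by omega
    simp only [List.map_cons, List.cons_append, IsTangleWord, Layer.shift, h4, true_and, h5]
    exact and_iff_right (by omega)

/-- Nonemptiness of `S` matters when `m = 0`: the box still demands `i ≤ N`, a condition that an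
empty word would lose. -/
theorem isTangleWord_glue {ε : Bool} {m : ℕ} (w₁ w₂ : List (Layer V)) (i : ℕ)
    (b : V m (regionShading ε i)) (S : List (Layer V)) (hne : S ≠ [])
    (hS : IsTangleWord (regionShading ε i) 0 S (2 * m)) (N M : ℕ) :
    IsTangleWord ε N (w₁ ++ boxAt i b :: w₂) M ↔
      IsTangleWord ε N (w₁ ++ S.map (Layer.shift i) ++ w₂) M := by
  rw [List.append_assoc]
  refine isTangleWord_append_congr (fun N => ?_) _ _
  by_cases hi : i ≤ N
  · obtain ⟨d, rfl⟩ := Nat.exists_eq_add_of_le hi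
    have h := isTangleWord_shift i d S w₂ 0 (2 * m) M hS
    rw [Nat.add_zero] at h
    rw [h]
    simp only [IsTangleWord, boxAt, Shape.dom, Shape.cod, Shape.ShadingOK, true_and]
    rw [show i + d - 0 + 2 * m = i + 2 * m + d by omega]
    exact and_iff_right (by omega)
  · constructor
    · intro h
      exact absurd h.1 (by simp [boxAt, Shape.dom]; omega)
    · intro h
      cases S with
      | nil => exact absurd rfl hne
      | cons l S => exact absurd h.1 (by simp [Layer.shift]; omega)

/-! ### Planar isotopy and gluing for `evalWord` -/

section Evaluation

variable [∀ n ε, AddCommGroup (V n ε)] [∀ n ε, Module ℂ (V n ε)] (P : PlanarAlgebra V)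

theorem PlanarAlgebra.evalWord_interchange (n : ℕ) (ε : Bool) (s t : Shape V) (i d : ℕ)
    (w₁ w₂ : List (Layer V)) :
    P.evalWord n ε (w₁ ++ [⟨i, s⟩, ⟨i + s.cod + d, t⟩] ++ w₂)
      = P.evalWord n ε (w₁ ++ [⟨i + s.dom + d, t⟩, ⟨i, s⟩] ++ w₂) := by
  have h := isTangleWord_interchange (ε := ε) s t i d w₁ w₂ 0 (2 * n)
  unfold PlanarAlgebra.evalWord
  split_ifs with h1 h2 h2
  · exact P.eval_isotopy _ _ ⟨w₁, w₂, _, _, Move.interchange s t i d, rfl, rfl⟩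
  · exact absurd (h.1 h1) h2
  · exact absurd (h.2 h2) h1
  · rfl

theorem PlanarAlgebra.evalWord_glue (n : ℕ) (ε : Bool) {m : ℕ} {η : Bool} (w₁ w₂ : List (Layer V))
    (i : ℕ) (S : List (Layer V)) (hne : S ≠ []) (hη : η = regionShading ε i)
    (hS : IsTangleWord η 0 S (2 * m)) :
    P.evalWord n ε (w₁ ++ boxAt i (P.evalWord m η S) :: w₂)
      = P.evalWord n ε (w₁ ++ S.map (Layer.shift i) ++ w₂) := by
  subst hη
  have h := isTangleWord_glue (ε := ε) w₁ w₂ i (P.evalWord m _ S) S hne hS 0 (2 * n)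
  have hS' : P.evalWord m (regionShading ε i) S = P.eval ⟨S, hS⟩ := dif_pos hS
  rw [hS'] at h ⊢
  unfold PlanarAlgebra.evalWord
  split_ifs with h1 h2 h2
  · exact P.eval_glue w₁ w₂ i ⟨S, hS⟩ h1 h2
  · exact absurd (h.1 h1) h2
  · exact absurd (h.2 h2) h1
  · rfl

theorem PlanarAlgebra.evalWord_boxAt_zero (n : ℕ) (ε : Bool) (a : V n ε) :
    P.evalWord n ε [boxAt 0 a] = a := by
  have h : IsTangleWord ε 0 [boxAt 0 a] (2 * n) := by
    simp [IsTangleWord, boxAt, Shape.dom, Shape.cod, Shape.ShadingOK, regionShading]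
  rw [PlanarAlgebra.evalWord, dif_pos h, P.eval_box]

/-- Caps whose left ends lie to the right of a cap can be drawn above this cap. -/
theorem PlanarAlgebra.evalWord_caps_cap (n : ℕ) (ε : Bool) (p : ℕ) (l : List ℕ)
    (hl : ∀ q ∈ l, p + 2 ≤ q) (w₁ w₂ : List (Layer V)) :
    P.evalWord n ε (w₁ ++ l.map capAt ++ capAt p :: w₂)
      = P.evalWord n ε (w₁ ++ capAt p :: l.map (fun q => capAt (q - 2)) ++ w₂) := by
  induction l generalizing w₁ with
  | nil => simp
  | cons q l ih =>
    -- The first cap of the list starts at `p + 2 + d`. Once the later caps have passed above `capAt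
    -- p`, one interchange moves this one too, lowering its position by two.
    obtain ⟨d, rfl⟩ := Nat.exists_eq_add_of_le (hl q (by simp))
    have h := ih (fun q hq => hl q (by simp [hq])) (w₁ ++ [capAt (p + 2 + d)])
    have h2 := P.evalWord_interchange n ε .cap .cap p d w₁
      (l.map (fun q => capAt (q - 2)) ++ w₂)
    simp only [Shape.cod, Shape.dom, List.append_assoc, List.cons_append, List.nil_append,
      Nat.add_zero, List.map_cons] at h h2 ⊢
    rw [h]
    refine h2.symm.trans ?_
    rw [show p + 2 + d - 2 = p + d by omega]
    rfl

end Evaluation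

theorem isTangleWord_concat_capAt {ε : Bool} (w : List (Layer V)) (p N M : ℕ) :
    IsTangleWord ε N (w ++ [capAt p]) M ↔ p ≤ M ∧ IsTangleWord ε N w (M + 2) := by
  induction w generalizing N with
  | nil =>
    simp only [List.nil_append, IsTangleWord, capAt, Shape.dom, Shape.cod, Shape.ShadingOK,
      true_and]
    constructor
    · rintro ⟨h1, h2⟩
      constructor <;> omega
    · rintro ⟨h1, h2⟩
      constructor <;> omega
  | cons l w ih =>
    simp only [List.cons_append, IsTangleWord, ih]
    tauto

theorem nestedCaps_eq_map (L c : ℕ) :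
    (nestedCaps L c : List (Layer V)) = ((List.range c).map fun j => L - 1 - j).map capAt := by
  simp [nestedCaps, Function.comp_def]

theorem nestedCaps_succ (L c : ℕ) :
    (nestedCaps L (c + 1) : List (Layer V)) = nestedCaps L c ++ [capAt (L - 1 - c)] := by
  simp [nestedCaps, List.range_succ]

theorem map_shift_zero (w : List (Layer V)) : w.map (Layer.shift 0) = w := by
  conv_rhs => rw [← List.map_id w]
  refine List.map_congr_left fun l _ => ?_
  simp [Layer.shift]

/-! ### The cap operators and their exchange relation -/

section Operators

variable [∀ n ε, AddCommGroup (V n ε)] [∀ n ε, Module ℂ (V n ε)] (P : PlanarAlgebra V)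
  (ε : Bool) (k : ℕ)

/-- If `w` is not a tangle of the right size, neither is its extension by a cap, and both sides
vanish. Keeping `N` as a variable accommodates indices such as `d + 1 + k`. -/
theorem PlanarAlgebra.evalWord_capAt {n N : ℕ} (hN : N = n + 1) (p : ℕ)
    (w : List (Layer V)) :
    P.evalWord n ε [boxAt 0 (P.evalWord N ε w), capAt p] = P.evalWord n ε (w ++ [capAt p]) := by
  subst hN
  by_cases h : IsTangleWord ε 0 w (2 * (n + 1))
  · have hne : w ≠ [] := by
      rintro rfl
      exact absurd (show 0 = 2 * (n + 1) from h) (by omega)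
    have := P.evalWord_glue n ε [] [capAt p] 0 w hne (by simp [regionShading]) h
    rw [List.nil_append, List.nil_append, map_shift_zero] at this
    exact this
  · have h1 : P.evalWord (n + 1) ε w = 0 := dif_neg h
    have h2 : P.evalWord n ε (w ++ [capAt p]) = 0 := by
      refine dif_neg fun h' => h ?_
      exact ((isTangleWord_concat_capAt w p 0 (2 * n)).1 h').2
    rw [h1, h2]
    exact (P.linearAction n ε [] 0 [capAt p]).map_zero

/-- A cap on a box can be absorbed into the box. -/
theorem PlanarAlgebra.evalWord_box_capAt {n N : ℕ} (hN : N = n + 1) (p : ℕ) (hp : p ≤ 2 * n)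
    (a : V N ε) (m : ℕ) (w w' : List (Layer V)) (i : ℕ) (η : Bool)
    (hη : ε = regionShading η i) :
    P.evalWord m η (w ++ boxAt i (P.evalWord n ε [boxAt 0 a, capAt p]) :: w')
      = P.evalWord m η (w ++ [boxAt i a, capAt (i + p)] ++ w') := by
  rw [P.evalWord_glue m η w w' i _ (by simp) hη]
  · rfl
  · subst hN
    simp only [IsTangleWord, boxAt, capAt, Shape.dom, Shape.cod, Shape.ShadingOK]
    refine ⟨by omega, by simp [regionShading], by omega, trivial, by omega⟩

/-- The homogeneous element of degree `d` given by a word. -/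
noncomputable def PlanarAlgebra.ofWord (d : ℕ) (w : List (Layer V)) : Graded V ε k :=
  DirectSum.lof ℂ ℕ (fun r => V (r + k) ε) d (P.evalWord (d + k) ε w)

/-- The cap joining the top strings number `p` and `p + 1` (zero if there are no such strings). -/
noncomputable def PlanarAlgebra.capOp (p : ℕ) : Module.End ℂ (Graded V ε k) :=
  DirectSum.toModule ℂ ℕ _ fun i =>
    if p + 2 ≤ 2 * i then
      DirectSum.lof ℂ ℕ (fun r => V (r + k) ε) (i - 1) ∘ₗ
        P.linearAction (i - 1 + k) ε [] 0 [capAt p]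
    else 0

theorem PlanarAlgebra.ofWord_boxAt_zero (d : ℕ) (a : V (d + k) ε) :
    P.ofWord ε k d [boxAt 0 a] = DirectSum.lof ℂ ℕ (fun r => V (r + k) ε) d a := by
  rw [PlanarAlgebra.ofWord, P.evalWord_boxAt_zero]

theorem PlanarAlgebra.capOp_lof_succ {p i : ℕ} (h : p ≤ 2 * i) (a : V (i + 1 + k) ε) :
    P.capOp ε k p (DirectSum.lof ℂ ℕ (fun r => V (r + k) ε) (i + 1) a)
      = DirectSum.lof ℂ ℕ (fun r => V (r + k) ε) i
          (P.evalWord (i + k) ε [boxAt 0 a, capAt p]) := by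
  rw [PlanarAlgebra.capOp, DirectSum.toModule_lof, if_pos (by omega)]
  rfl

theorem PlanarAlgebra.capOp_lof_eq_zero {p i : ℕ} (h : 2 * i < p + 2) (a : V (i + k) ε) :
    P.capOp ε k p (DirectSum.lof ℂ ℕ (fun r => V (r + k) ε) i a) = 0 := by
  rw [PlanarAlgebra.capOp, DirectSum.toModule_lof, if_neg (by omega)]
  rfl

theorem PlanarAlgebra.capOp_ofWord {p d : ℕ} (h : p ≤ 2 * d) (w : List (Layer V)) :
    P.capOp ε k p (P.ofWord ε k (d + 1) w) = P.ofWord ε k d (w ++ [capAt p]) := by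
  rw [PlanarAlgebra.ofWord, P.capOp_lof_succ ε k h, PlanarAlgebra.ofWord,
    P.evalWord_capAt ε (by omega) p]

theorem PlanarAlgebra.capOp_ofWord_eq_zero {p d : ℕ} (h : 2 * d < p + 2) (w : List (Layer V)) :
    P.capOp ε k p (P.ofWord ε k d w) = 0 :=
  P.capOp_lof_eq_zero ε k h _

theorem PlanarAlgebra.ofWord_congr {d : ℕ} {w w' : List (Layer V)}
    (h : P.evalWord (d + k) ε w = P.evalWord (d + k) ε w') :
    P.ofWord ε k d w = P.ofWord ε k d w' := by
  rw [PlanarAlgebra.ofWord, h, PlanarAlgebra.ofWord]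

/-- The cap at `p` removes two strings, so strings `q, q + 1` above it are `q + 2, q + 3` below it,
and the two caps are disjoint. The case split checks that both sides vanish together when strings
are missing. -/
theorem PlanarAlgebra.capOp_mul_capOp {p q : ℕ} (h : p ≤ q) :
    P.capOp ε k q * P.capOp ε k p = P.capOp ε k p * P.capOp ε k (q + 2) := by
  refine DirectSum.linearMap_ext ℂ fun i => LinearMap.ext fun a => ?_
  simp only [LinearMap.comp_apply, Module.End.mul_apply]
  rw [← P.ofWord_boxAt_zero]
  match i, a with
  | 0, a =>
    rw [P.capOp_ofWord_eq_zero ε k (by omega), P.capOp_ofWord_eq_zero ε k (by omega), map_zero,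
      map_zero]
  | 1, a =>
    rw [P.capOp_ofWord_eq_zero ε k (by omega : 2 * 1 < q + 2 + 2), map_zero]
    by_cases hp : p ≤ 2 * 0
    · rw [P.capOp_ofWord ε k hp, P.capOp_ofWord_eq_zero ε k (by omega)]
    · rw [P.capOp_ofWord_eq_zero ε k (by omega), map_zero]
  | i + 2, a =>
    by_cases hq : q ≤ 2 * i
    · rw [P.capOp_ofWord ε k (by omega), P.capOp_ofWord ε k (by omega),
        P.capOp_ofWord ε k (by omega), P.capOp_ofWord ε k (by omega)]
      apply P.ofWord_congr
      simpa using P.evalWord_caps_cap (i + k) ε p [q + 2] (by simp; omega) [boxAt 0 a] []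
        |>.symm
    · rw [P.capOp_ofWord_eq_zero ε k (by omega : 2 * (i + 2) < q + 2 + 2), map_zero]
      by_cases hp : p ≤ 2 * (i + 1)
      · rw [P.capOp_ofWord ε k hp, P.capOp_ofWord_eq_zero ε k (by omega)]
      · rw [P.capOp_ofWord_eq_zero ε k (by omega), map_zero]

/-! ### Caps on products -/

/-- The product of two homogeneous elements along `i` top strings, in the graded space. -/
noncomputable def PlanarAlgebra.gradedContract (m n i : ℕ) :
    V (m + k) ε →ₗ[ℂ] V (n + k) ε →ₗ[ℂ] Graded V ε k :=
  (P.contract ε k m n i).compr₂ (DirectSum.lof ℂ ℕ (fun r => V (r + k) ε) (m + n - i))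

theorem PlanarAlgebra.gradedContract_apply {m n i d : ℕ} (hd : m + n - i = d)
    (a : V (m + k) ε) (b : V (n + k) ε) :
    P.gradedContract ε k m n i a b = P.ofWord ε k d (productWord i a b) := by
  subst hd
  rfl

/-- The capped strings are uncontracted strings of `a`. The cap lies to the left of all later pieces
and slides down past the nested caps and then past `b`, onto `a`. -/
theorem PlanarAlgebra.capOp_gradedContract_left {m n i p : ℕ} (hi : i ≤ 2 * n)
    (hp : p + i ≤ 2 * m) (a : V (m + 1 + k) ε) (b : V (n + k) ε) :
    P.capOp ε k p (P.gradedContract ε k (m + 1) n i a b)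
      = P.gradedContract ε k m n i (P.evalWord (m + k) ε [boxAt 0 a, capAt p]) b := by
  rw [P.gradedContract_apply ε k (d := m + n - i + 1) (by omega),
    P.gradedContract_apply ε k rfl, P.capOp_ofWord ε k (by omega)]
  apply P.ofWord_congr
  have hglue := P.evalWord_box_capAt ε (n := m + k) (by omega) p (by omega) a (m + n - i + k) []
    ([boxAt (2 * m) b] ++ nestedCaps (2 * m + 2 * n + 2 * k) k ++ nestedCaps (2 * m) i) 0 ε
    (by simp [regionShading])
  have hcaps := P.evalWord_caps_cap (m + n - i + k) ε p
    ((List.range k).map (fun j => 2 * (m + 1) + 2 * n + 2 * k - 1 - j)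
      ++ (List.range i).map (fun j => 2 * (m + 1) - 1 - j))
    (by
      intro q hq
      simp only [List.mem_append, List.mem_map, List.mem_range] at hq
      omega)
    [boxAt 0 a, boxAt (2 * (m + 1)) b] []
  have hbox := P.evalWord_interchange (m + n - i + k) ε .cap (.box (n + k) ε b) p (2 * m - p)
    [boxAt 0 a] (nestedCaps (2 * m + 2 * n + 2 * k) k ++ nestedCaps (2 * m) i)
  simp only [List.append_assoc, List.cons_append, List.nil_append, productWord,
    nestedCaps_eq_map, List.map_append, List.map_map, Function.comp_def, Nat.zero_add,
    List.append_nil] at hglue hcaps hbox ⊢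
  rw [hglue, hcaps]
  have e1 : p + (Shape.cap : Shape V).cod + (2 * m - p) = 2 * m := by
    simp only [Shape.cod]; omega
  have e2 : p + (Shape.cap : Shape V).dom + (2 * m - p) = 2 * (m + 1) := by
    simp only [Shape.dom]; omega
  have e3 : ∀ j, 2 * (m + 1) + 2 * n + 2 * k - 1 - j - 2 = 2 * m + 2 * n + 2 * k - 1 - j := by
    intro j; omega
  have e4 : ∀ j, 2 * (m + 1) - 1 - j - 2 = 2 * m - 1 - j := by
    intro j; omega
  rw [e1, e2] at hbox
  simp only [e3, e4]
  exact hbox.symm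

/-- With no top strings contracted, only the `k` side caps separate the cap from `b`, and they lie
to its right. -/
theorem PlanarAlgebra.capOp_gradedContract_zero_right {m n p : ℕ}
    (hp : p ≤ 2 * n) (a : V (m + k) ε) (b : V (n + 1 + k) ε) :
    P.capOp ε k (2 * m + p) (P.gradedContract ε k m (n + 1) 0 a b)
      = P.gradedContract ε k m n 0 a (P.evalWord (n + k) ε [boxAt 0 b, capAt p]) := by
  rw [P.gradedContract_apply ε k (d := m + n + 1) (by omega),
    P.gradedContract_apply ε k (d := m + n) rfl, P.capOp_ofWord ε k (by omega)]
  apply P.ofWord_congr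
  have hglue := P.evalWord_box_capAt ε (n := n + k) (by omega) p (by omega) b (m + n + k)
    [boxAt 0 a]
    (nestedCaps (2 * m + 2 * n + 2 * k) k ++ nestedCaps (2 * m) 0) (2 * m) ε
    (regionShading_two_mul ε m).symm
  have hcaps := P.evalWord_caps_cap (m + n + k) ε (2 * m + p)
    ((List.range k).map (fun j => 2 * m + 2 * (n + 1) + 2 * k - 1 - j))
    (by
      intro q hq
      simp only [List.mem_map, List.mem_range] at hq
      omega)
    [boxAt 0 a, boxAt (2 * m) b] []
  simp only [List.cons_append, List.nil_append, productWord,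
    nestedCaps_eq_map, List.map_map, Function.comp_def, List.range_zero, List.map_nil,
    List.append_nil] at hglue hcaps ⊢
  rw [hglue, hcaps]
  have e3 : ∀ j, 2 * m + 2 * (n + 1) + 2 * k - 1 - j - 2 = 2 * m + 2 * n + 2 * k - 1 - j := by
    intro j; omega
  simp only [e3]

/-- String `p` is the last free one of `a` and `p + 1` the first free one of `b`. The nested caps
are listed outwards, so the new cap is just the next entry. -/
theorem PlanarAlgebra.capOp_gradedContract_middle {m n i p : ℕ} (hp : p + 1 + i = 2 * m)
    (hi : i + 1 ≤ 2 * n) (a : V (m + k) ε) (b : V (n + k) ε) :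
    P.capOp ε k p (P.gradedContract ε k m n i a b)
      = P.gradedContract ε k m n (i + 1) a b := by
  rw [P.gradedContract_apply ε k (d := m + n - (i + 1) + 1) (by omega),
    P.gradedContract_apply ε k rfl, P.capOp_ofWord ε k (by omega)]
  apply P.ofWord_congr
  simp only [productWord, nestedCaps_succ, List.append_assoc]
  rw [show 2 * m - 1 - i = p by omega]

/-- All top strings of `b` are used up, so `p` is the last remaining string and has no right
neighbour. -/
theorem PlanarAlgebra.capOp_gradedContract_eq_zero {m n i p : ℕ} (hp : p + 1 + i = 2 * m)
    (hi : i = 2 * n) (a : V (m + k) ε) (b : V (n + k) ε) :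
    P.capOp ε k p (P.gradedContract ε k m n i a b) = 0 := by
  rw [P.gradedContract_apply ε k rfl]
  exact P.capOp_ofWord_eq_zero ε k (by omega) _

end Operators

/-! ### The ordered product of the factors `1 + c_p` -/

section Products

variable [∀ n ε, AddCommGroup (V n ε)] [∀ n ε, Module ℂ (V n ε)] (P : PlanarAlgebra V)
  (ε : Bool) (k : ℕ)

theorem PlanarAlgebra.capOp_lof (p i : ℕ) (a : V (i + k) ε) :
    P.capOp ε k p (DirectSum.lof ℂ ℕ (fun r => V (r + k) ε) i a) = 0 ∨
      ∃ j b, i = j + 1 ∧ p ≤ 2 * j ∧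
        P.capOp ε k p (DirectSum.lof ℂ ℕ (fun r => V (r + k) ε) i a)
          = DirectSum.lof ℂ ℕ (fun r => V (r + k) ε) j b := by
  by_cases h : 2 * i < p + 2
  · exact Or.inl (P.capOp_lof_eq_zero ε k h a)
  · obtain ⟨j, rfl⟩ : ∃ j, i = j + 1 := ⟨i - 1, by omega⟩
    exact Or.inr ⟨j, _, rfl, by omega, P.capOp_lof_succ ε k (by omega) a⟩

/-- The product `(1 + c_s) (1 + c_{s+1}) ⋯ (1 + c_{s+t-1})`, where `c_p` is the cap at `p`. -/
noncomputable def PlanarAlgebra.capProd (s : ℕ) : ℕ → Module.End ℂ (Graded V ε k)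
  | 0 => 1
  | t + 1 => (1 + P.capOp ε k s) * PlanarAlgebra.capProd (s + 1) t

theorem PlanarAlgebra.capProd_succ (s t : ℕ) :
    P.capProd ε k s (t + 1) = P.capProd ε k s t * (1 + P.capOp ε k (s + t)) := by
  induction t generalizing s with
  | zero => simp [PlanarAlgebra.capProd]
  | succ t ih =>
    rw [PlanarAlgebra.capProd, ih, PlanarAlgebra.capProd, mul_assoc,
      show s + 1 + t = s + (t + 1) by omega]

theorem PlanarAlgebra.capProd_mul_capOp {p s : ℕ} (h : p ≤ s) (t : ℕ) :
    P.capProd ε k s t * P.capOp ε k p = P.capOp ε k p * P.capProd ε k (s + 2) t := by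
  induction t generalizing s with
  | zero => simp [PlanarAlgebra.capProd]
  | succ t ih =>
    rw [PlanarAlgebra.capProd, PlanarAlgebra.capProd, mul_assoc, ih (by omega), ← mul_assoc,
      ← mul_assoc, add_mul, mul_add, P.capOp_mul_capOp ε k h, one_mul, mul_one,
      show s + 1 + 2 = s + 2 + 1 by omega]

theorem PlanarAlgebra.capProd_lof_of_le {s t t' i : ℕ} (h : 2 * i ≤ s + t + 1) (ht : t ≤ t')
    (a : V (i + k) ε) :
    P.capProd ε k s t' (DirectSum.lof ℂ ℕ (fun r => V (r + k) ε) i a)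
      = P.capProd ε k s t (DirectSum.lof ℂ ℕ (fun r => V (r + k) ε) i a) := by
  induction t', ht using Nat.le_induction with
  | base => rfl
  | succ t' ht ih =>
    rw [P.capProd_succ, Module.End.mul_apply, LinearMap.add_apply, Module.End.one_apply,
      P.capOp_lof_eq_zero ε k (by omega), add_zero, ih]

/-- The locally finite product `(1 + c_s) (1 + c_{s+1}) ⋯`. -/
noncomputable def PlanarAlgebra.capTail (s : ℕ) : Module.End ℂ (Graded V ε k) :=
  DirectSum.toModule ℂ ℕ _ fun i =>
    -- Degree `i` has `2 * i` top strings, so the omitted factors `1 + c_p`, with `p ≥ s + 2 * i`,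
    -- act there as the identity.
    P.capProd ε k s (2 * i) ∘ₗ DirectSum.lof ℂ ℕ (fun r => V (r + k) ε) i

theorem PlanarAlgebra.capTail_lof {s t i : ℕ} (h : 2 * i ≤ s + t + 1) (a : V (i + k) ε) :
    P.capTail ε k s (DirectSum.lof ℂ ℕ (fun r => V (r + k) ε) i a)
      = P.capProd ε k s t (DirectSum.lof ℂ ℕ (fun r => V (r + k) ε) i a) := by
  rw [PlanarAlgebra.capTail, DirectSum.toModule_lof, LinearMap.comp_apply]
  rcases le_total t (2 * i) with h' | h'
  · exact P.capProd_lof_of_le ε k h h' a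
  · exact (P.capProd_lof_of_le ε k (by omega) h' a).symm

theorem PlanarAlgebra.capTail_eq_mul (s : ℕ) :
    P.capTail ε k s = (1 + P.capOp ε k s) * P.capTail ε k (s + 1) := by
  refine DirectSum.linearMap_ext ℂ fun i => LinearMap.ext fun a => ?_
  rw [LinearMap.comp_apply, LinearMap.comp_apply, Module.End.mul_apply,
    P.capTail_lof ε k (t := 2 * i + 1) (by omega), P.capTail_lof ε k (t := 2 * i) (by omega)]
  rfl

theorem PlanarAlgebra.capTail_mul_capOp (s : ℕ) :
    P.capTail ε k s * P.capOp ε k s = P.capOp ε k s * P.capTail ε k (s + 2) := by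
  refine DirectSum.linearMap_ext ℂ fun i => LinearMap.ext fun a => ?_
  rw [LinearMap.comp_apply, LinearMap.comp_apply, Module.End.mul_apply, Module.End.mul_apply,
    P.capTail_lof ε k (t := 2 * i) (by omega), ← Module.End.mul_apply,
    ← Module.End.mul_apply (f := P.capOp ε k s), ← P.capProd_mul_capOp ε k le_rfl,
    Module.End.mul_apply, Module.End.mul_apply]
  rcases P.capOp_lof ε k s i a with h | ⟨j, b, rfl, -, h⟩
  · rw [h, map_zero, map_zero]
  · rw [h, P.capTail_lof ε k (t := 2 * (j + 1)) (by omega)]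

/-- The sum `1 + c_{s-1} + c_{s-2} c_{s-1} + ⋯ + c_0 ⋯ c_{s-1}`. -/
noncomputable def PlanarAlgebra.capRuns : ℕ → Module.End ℂ (Graded V ε k)
  | 0 => 1
  | s + 1 => 1 + PlanarAlgebra.capRuns s * P.capOp ε k s

/-- Expanding `T_{s+1} = (1 + c_{s+1}) T_{s+2}` and moving `c_s` through `T_s` reduces this to
`R_{s+1}(1 + c_{s+1}) = R_{s+2} + R_s c_s`, which follows from the definition of `R`. It matches the
recursion of the sums of epi diagrams. -/
theorem PlanarAlgebra.capRuns_mul_capTail_succ (s : ℕ) :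
    P.capRuns ε k (s + 1) * P.capTail ε k (s + 1)
      = P.capRuns ε k (s + 2) * P.capTail ε k (s + 2)
        + P.capRuns ε k s * P.capTail ε k s * P.capOp ε k s := by
  rw [P.capTail_eq_mul ε k (s + 1), mul_assoc (P.capRuns ε k s), P.capTail_mul_capOp]
  simp only [PlanarAlgebra.capRuns]
  noncomm_ring

theorem PlanarAlgebra.capRuns_mul_capTail_lof {s i : ℕ} (h : 2 * i ≤ s) (a : V (i + k) ε) :
    (P.capRuns ε k s * P.capTail ε k s) (DirectSum.lof ℂ ℕ (fun r => V (r + k) ε) i a)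
      = DirectSum.lof ℂ ℕ (fun r => V (r + k) ε) i a := by
  rw [Module.End.mul_apply, P.capTail_lof ε k (t := 0) (by omega), PlanarAlgebra.capProd,
    Module.End.one_apply]
  cases s with
  | zero => rfl
  | succ s =>
    rw [PlanarAlgebra.capRuns, LinearMap.add_apply, Module.End.mul_apply,
      P.capOp_lof_eq_zero ε k (by omega), map_zero, add_zero, Module.End.one_apply]

/-- Sequences of operators with the recursion of the sums of epi diagrams. -/
theorem PlanarAlgebra.eq_capTail_of_recursion (F : ℕ → Module.End ℂ (Graded V ε k))
    (h0 : F 0 = F 1) (hrec : ∀ s, F (s + 1) = F (s + 2) + F s * P.capOp ε k s)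
    (hbase : ∀ s i, 2 * i ≤ s → ∀ a : V (i + k) ε,
      F s (DirectSum.lof ℂ ℕ (fun r => V (r + k) ε) i a)
        = DirectSum.lof ℂ ℕ (fun r => V (r + k) ε) i a) :
    F 0 = P.capTail ε k 0 := by
  have hZ : P.capRuns ε k 1 * P.capTail ε k 1 = P.capTail ε k 0 := by
    rw [P.capTail_eq_mul ε k 0]
    simp [PlanarAlgebra.capRuns]
  -- Outer induction on the degree, which `c_s` lowers; inner descent in `s` from the range `2 * i ≤
  -- s`, where both sides are the identity. The descent reaches only positive indices, so index `0`
  -- comes from `h0` and `R_1 T_1 = T_0`.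
  have key : ∀ i s, ∀ a : V (i + k) ε,
      F s (DirectSum.lof ℂ ℕ (fun r => V (r + k) ε) i a)
        = (P.capRuns ε k s * P.capTail ε k s)
          (DirectSum.lof ℂ ℕ (fun r => V (r + k) ε) i a) := by
    intro i
    induction i using Nat.strong_induction_on with
    | _ i ih =>
      have hpos : ∀ d s, 2 * i ≤ s + 1 + d → ∀ a : V (i + k) ε,
          F (s + 1) (DirectSum.lof ℂ ℕ (fun r => V (r + k) ε) i a)
            = (P.capRuns ε k (s + 1) * P.capTail ε k (s + 1))
              (DirectSum.lof ℂ ℕ (fun r => V (r + k) ε) i a) := by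
        intro d
        induction d with
        | zero => intro s hs a; rw [hbase _ _ hs, P.capRuns_mul_capTail_lof ε k hs]
        | succ d ihd =>
          intro s hs a
          rw [hrec, P.capRuns_mul_capTail_succ, LinearMap.add_apply, LinearMap.add_apply,
            ihd (s + 1) (by omega), Module.End.mul_apply (F s),
            Module.End.mul_apply (P.capRuns ε k s * P.capTail ε k s)]
          rcases P.capOp_lof ε k s i a with h | ⟨j, b, rfl, -, h⟩
          · rw [h, map_zero, map_zero]
          · rw [h, ih j (by omega)]
      intro s a
      cases s with
      | zero =>
        rw [h0, hpos (2 * i) 0 (by omega), hZ]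
        simp [PlanarAlgebra.capRuns]
      | succ s => exact hpos (2 * i) s (by omega) a
  refine DirectSum.linearMap_ext ℂ fun i => LinearMap.ext fun a => ?_
  rw [LinearMap.comp_apply, LinearMap.comp_apply, key]
  simp [PlanarAlgebra.capRuns]

/-- Sequences of operators with the recursion of the signed sums of non-nested epi diagrams. -/
theorem PlanarAlgebra.mul_capTail_of_recursion (G : ℕ → Module.End ℂ (Graded V ε k))
    (h0 : G 0 = G 1) (hrec : ∀ s, G (s + 1) = G (s + 2) - G (s + 1) * P.capOp ε k s)
    (hbase : ∀ s i, 2 * i ≤ s → ∀ a : V (i + k) ε,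
      G s (DirectSum.lof ℂ ℕ (fun r => V (r + k) ε) i a)
        = DirectSum.lof ℂ ℕ (fun r => V (r + k) ε) i a) :
    G 0 * P.capTail ε k 0 = 1 := by
  -- The recursion reads `G (s + 2) = G (s + 1) * (1 + c_s)`, so the product telescopes.
  have key : ∀ t, G 1 * P.capProd ε k 0 t = G (t + 1) := by
    intro t
    induction t with
    | zero => simp [PlanarAlgebra.capProd]
    | succ t ih =>
      rw [P.capProd_succ, ← mul_assoc, ih, mul_add, mul_one, Nat.zero_add]
      nth_rewrite 1 [hrec t]
      abel
  refine DirectSum.linearMap_ext ℂ fun i => LinearMap.ext fun a => ?_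
  rw [LinearMap.comp_apply, LinearMap.comp_apply, Module.End.mul_apply,
    P.capTail_lof ε k (t := 2 * i) (by omega), h0, ← Module.End.mul_apply, key,
    hbase _ _ (by omega), Module.End.one_apply]

/-! ### Surjectivity -/

/-- Sums of homogeneous elements of degrees less than `i`. -/
def lowerDegree (V : ℕ → Bool → Type u) [∀ n ε, AddCommGroup (V n ε)]
    [∀ n ε, Module ℂ (V n ε)] (ε : Bool) (k i : ℕ) : Submodule ℂ (Graded V ε k) :=
  Submodule.span ℂ {x | ∃ j < i, ∃ a, x = DirectSum.lof ℂ ℕ (fun r => V (r + k) ε) j a}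

theorem PlanarAlgebra.capOp_mem_lowerDegree (p i : ℕ) {x : Graded V ε k}
    (hx : x ∈ lowerDegree V ε k (i + 1)) : P.capOp ε k p x ∈ lowerDegree V ε k i := by
  induction hx using Submodule.span_induction with
  | mem x h =>
    obtain ⟨j, hj, a, rfl⟩ := h
    rcases P.capOp_lof ε k p j a with h | ⟨j, b, rfl, -, h⟩
    · rw [h]; exact Submodule.zero_mem _
    · rw [h]; exact Submodule.subset_span ⟨j, by omega, b, rfl⟩
  | zero => rw [map_zero]; exact Submodule.zero_mem _
  | add x y _ _ hx hy => rw [map_add]; exact Submodule.add_mem _ hx hy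
  | smul c x _ hx => rw [map_smul]; exact Submodule.smul_mem _ _ hx

theorem lowerDegree_le_succ (i : ℕ) : lowerDegree V ε k i ≤ lowerDegree V ε k (i + 1) := by
  refine Submodule.span_mono ?_
  rintro x ⟨j, hj, a, rfl⟩
  exact ⟨j, by omega, a, rfl⟩

/-- Unitriangularity: every term of the expanded product other than `1` contains a cap, which lowers
the degree. -/
theorem PlanarAlgebra.capProd_sub_mem_lowerDegree (s t i : ℕ) {x : Graded V ε k}
    (hx : x ∈ lowerDegree V ε k (i + 1)) :
    P.capProd ε k s t x - x ∈ lowerDegree V ε k i := by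
  induction t generalizing x with
  | zero => simp [PlanarAlgebra.capProd]
  | succ t ih =>
    have h1 := P.capOp_mem_lowerDegree ε k (s + t) i hx
    have h2 := ih (Submodule.add_mem _ hx (lowerDegree_le_succ ε k i h1))
    rw [P.capProd_succ, Module.End.mul_apply, LinearMap.add_apply, Module.End.one_apply]
    have h3 := Submodule.add_mem _ h2 h1
    convert h3 using 1
    abel

/-- Induction on degree: `x = T x - (T x - x)`, and the bracket is in the range because it has lower
degree. -/
theorem PlanarAlgebra.capTail_surjective (s : ℕ) : Function.Surjective (P.capTail ε k s) := by
  have key : ∀ i, lowerDegree V ε k i ≤ LinearMap.range (P.capTail ε k s) := by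
    intro i
    induction i with
    | zero =>
      refine Submodule.span_le.2 ?_
      rintro x ⟨j, hj, a, rfl⟩
      omega
    | succ i ih =>
      refine Submodule.span_le.2 ?_
      rintro x ⟨j, hj, a, rfl⟩
      have h1 : DirectSum.lof ℂ ℕ (fun r => V (r + k) ε) j a ∈ lowerDegree V ε k (i + 1) :=
        Submodule.subset_span ⟨j, hj, a, rfl⟩
      have h2 := ih (P.capProd_sub_mem_lowerDegree ε k s (2 * j) i h1)
      rw [← P.capTail_lof ε k (by omega)] at h2
      have h3 := Submodule.sub_mem _ (LinearMap.mem_range_self (P.capTail ε k s)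
        (DirectSum.lof ℂ ℕ (fun r => V (r + k) ε) j a)) h2
      rwa [sub_sub_cancel] at h3
  rw [← LinearMap.range_eq_top, eq_top_iff]
  intro x _
  induction x using DirectSum.induction_on with
  | zero => exact Submodule.zero_mem _
  | of i a => exact key (i + 1) (Submodule.subset_span ⟨i, by omega, a, rfl⟩)
  | add x y hx hy => exact Submodule.add_mem _ (hx trivial) (hy trivial)

/-! ### The orthogonal product -/

theorem bilinearExtension_lof {ε : Bool} {k : ℕ}
    (B : ∀ m n : ℕ, V (m + k) ε →ₗ[ℂ] V (n + k) ε →ₗ[ℂ] Graded V ε k) (m n : ℕ)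
    (a : V (m + k) ε) (b : V (n + k) ε) :
    bilinearExtension B (DirectSum.lof ℂ ℕ (fun r => V (r + k) ε) m a)
      (DirectSum.lof ℂ ℕ (fun r => V (r + k) ε) n b) = B m n a b := by
  rw [bilinearExtension, DirectSum.toModule_lof, LinearMap.flip_apply, DirectSum.toModule_lof,
    LinearMap.flip_apply]

theorem PlanarAlgebra.juxt_lof (m n : ℕ) (a : V (m + k) ε) (b : V (n + k) ε) :
    P.juxt ε k (DirectSum.lof ℂ ℕ (fun r => V (r + k) ε) m a)
      (DirectSum.lof ℂ ℕ (fun r => V (r + k) ε) n b) = P.gradedContract ε k m n 0 a b :=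
  bilinearExtension_lof _ m n a b

theorem PlanarAlgebra.capOp_juxt (m p : ℕ) (a : V (m + k) ε) (y : Graded V ε k) :
    P.capOp ε k (2 * m + p) (P.juxt ε k (DirectSum.lof ℂ ℕ (fun r => V (r + k) ε) m a) y)
      = P.juxt ε k (DirectSum.lof ℂ ℕ (fun r => V (r + k) ε) m a) (P.capOp ε k p y) := by
  suffices h : P.capOp ε k (2 * m + p) ∘ₗ
        P.juxt ε k (DirectSum.lof ℂ ℕ (fun r => V (r + k) ε) m a)
      = P.juxt ε k (DirectSum.lof ℂ ℕ (fun r => V (r + k) ε) m a) ∘ₗ P.capOp ε k p from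
    LinearMap.congr_fun h y
  refine DirectSum.linearMap_ext ℂ fun n => LinearMap.ext fun b => ?_
  simp only [LinearMap.comp_apply]
  rw [P.juxt_lof]
  by_cases h : 2 * n < p + 2
  · rw [P.capOp_lof_eq_zero ε k h, map_zero, P.gradedContract_apply ε k (d := m + n) rfl,
      P.capOp_ofWord_eq_zero ε k (by omega)]
  · obtain ⟨n, rfl⟩ : ∃ n', n = n' + 1 := ⟨n - 1, by omega⟩
    rw [P.capOp_lof_succ ε k (by omega), P.juxt_lof,
      P.capOp_gradedContract_zero_right ε k (by omega)]

/-- The part of the orthogonal product in which the first `s` top strings of the left factor are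
not joined to the right factor. -/
noncomputable def PlanarAlgebra.partialOrthProd (s : ℕ) :
    Graded V ε k →ₗ[ℂ] Graded V ε k →ₗ[ℂ] Graded V ε k :=
  bilinearExtension fun m n =>
    ∑ i ∈ Finset.range (min (2 * m - s) (2 * n) + 1), P.gradedContract ε k m n i

theorem PlanarAlgebra.partialOrthProd_lof (s m n : ℕ) (a : V (m + k) ε) (b : V (n + k) ε) :
    P.partialOrthProd ε k s (DirectSum.lof ℂ ℕ (fun r => V (r + k) ε) m a)
      (DirectSum.lof ℂ ℕ (fun r => V (r + k) ε) n b)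
      = ∑ i ∈ Finset.range (min (2 * m - s) (2 * n) + 1), P.gradedContract ε k m n i a b := by
  rw [PlanarAlgebra.partialOrthProd, bilinearExtension_lof, LinearMap.sum_apply,
    LinearMap.sum_apply]

theorem PlanarAlgebra.partialOrthProd_two_mul (m : ℕ) (a : V (m + k) ε) (y : Graded V ε k) :
    P.partialOrthProd ε k (2 * m) (DirectSum.lof ℂ ℕ (fun r => V (r + k) ε) m a) y
      = P.juxt ε k (DirectSum.lof ℂ ℕ (fun r => V (r + k) ε) m a) y := by
  suffices h : P.partialOrthProd ε k (2 * m) (DirectSum.lof ℂ ℕ (fun r => V (r + k) ε) m a)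
      = P.juxt ε k (DirectSum.lof ℂ ℕ (fun r => V (r + k) ε) m a) from
    LinearMap.congr_fun h y
  refine DirectSum.linearMap_ext ℂ fun n => LinearMap.ext fun b => ?_
  simp only [LinearMap.comp_apply]
  rw [P.juxt_lof, P.partialOrthProd_lof]
  simp

/-- For `i < 2 * m - s - 1` the strings `s, s + 1` both belong to `a`, so the cap acts on `a`. For
`i = 2 * m - s - 1` they straddle the seam: the cap produces the extra contraction present at stage
`s`, or zero if `b` has no string left. The three cases say whether this seam term is absent, killed
or productive. -/
theorem PlanarAlgebra.one_add_capOp_partialOrthProd_lof {s m n : ℕ} (h : s < 2 * m)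
    (a : V (m + k) ε) (b : V (n + k) ε) :
    P.partialOrthProd ε k (s + 1) (DirectSum.lof ℂ ℕ (fun r => V (r + k) ε) m a)
        (DirectSum.lof ℂ ℕ (fun r => V (r + k) ε) n b)
      + P.capOp ε k s (P.partialOrthProd ε k (s + 1)
        (DirectSum.lof ℂ ℕ (fun r => V (r + k) ε) m a)
        (DirectSum.lof ℂ ℕ (fun r => V (r + k) ε) n b))
    = P.partialOrthProd ε k s (DirectSum.lof ℂ ℕ (fun r => V (r + k) ε) m a)
        (DirectSum.lof ℂ ℕ (fun r => V (r + k) ε) n b)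
      + P.partialOrthProd ε k s
        (P.capOp ε k s (DirectSum.lof ℂ ℕ (fun r => V (r + k) ε) m a))
        (DirectSum.lof ℂ ℕ (fun r => V (r + k) ε) n b) := by
  obtain ⟨m, rfl⟩ : ∃ m', m = m' + 1 := ⟨m - 1, by omega⟩
  have hleft : ∀ K ≤ 2 * n + 1, K + s ≤ 2 * m + 1 →
      P.capOp ε k s (∑ i ∈ Finset.range K, P.gradedContract ε k (m + 1) n i a b)
        = ∑ i ∈ Finset.range K,
          P.gradedContract ε k m n i (P.evalWord (m + k) ε [boxAt 0 a, capAt s]) b := by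
    intro K hK hs
    rw [map_sum]
    refine Finset.sum_congr rfl fun i hi => ?_
    have := Finset.mem_range.1 hi
    exact P.capOp_gradedContract_left ε k (by omega) (by omega) a b
  -- This covers `s = 2 * m + 1`, where `a` has no string `s + 1`: the capped factor is zero and the
  -- sum is empty.
  have hcap : ∀ K, K = 2 * m + 1 - s → K ≤ 2 * n →
      P.partialOrthProd ε k s
        (P.capOp ε k s (DirectSum.lof ℂ ℕ (fun r => V (r + k) ε) (m + 1) a))
        (DirectSum.lof ℂ ℕ (fun r => V (r + k) ε) n b)
      = ∑ i ∈ Finset.range K,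
          P.gradedContract ε k m n i (P.evalWord (m + k) ε [boxAt 0 a, capAt s]) b := by
    rintro K rfl hK
    by_cases hs : s ≤ 2 * m
    · rw [P.capOp_lof_succ ε k hs, P.partialOrthProd_lof,
        show min (2 * m - s) (2 * n) + 1 = 2 * m + 1 - s by omega]
    · rw [P.capOp_lof_eq_zero ε k (by omega), map_zero, LinearMap.zero_apply,
        show 2 * m + 1 - s = 0 by omega, Finset.sum_range_zero]
  rw [P.partialOrthProd_lof, P.partialOrthProd_lof]
  rcases lt_trichotomy (2 * n) (2 * m + 1 - s) with hn | hn | hn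
  · rw [show min (2 * (m + 1) - (s + 1)) (2 * n) + 1 = 2 * n + 1 by omega,
      show min (2 * (m + 1) - s) (2 * n) + 1 = 2 * n + 1 by omega,
      hleft _ le_rfl (by omega), P.capOp_lof_succ ε k (by omega), P.partialOrthProd_lof,
      show min (2 * m - s) (2 * n) + 1 = 2 * n + 1 by omega]
  · rw [show min (2 * (m + 1) - (s + 1)) (2 * n) + 1 = (2 * m + 1 - s) + 1 by omega,
      show min (2 * (m + 1) - s) (2 * n) + 1 = (2 * m + 1 - s) + 1 by omega,
      hcap _ rfl (by omega)]
    congr 1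
    rw [Finset.sum_range_succ, map_add, hleft _ (by omega) (by omega),
      P.capOp_gradedContract_eq_zero ε k (by omega) (by omega), add_zero]
  · rw [show min (2 * (m + 1) - (s + 1)) (2 * n) + 1 = (2 * m + 1 - s) + 1 by omega,
      show min (2 * (m + 1) - s) (2 * n) + 1 = (2 * m + 1 - s) + 1 + 1 by omega,
      hcap _ rfl (by omega), Finset.sum_range_succ _ (2 * m + 1 - s + 1),
      add_assoc (Finset.sum _ _)]
    congr 1
    rw [Finset.sum_range_succ, map_add, hleft _ (by omega) (by omega),
      P.capOp_gradedContract_middle ε k (by omega) (by omega), add_comm]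

/-- The sum of the images of the juxtaposition of `x` and `y` under the epi diagrams all of whose
turn-backs have left ends beyond the first `s` strings and join no two strings of `x`. -/
noncomputable def PlanarAlgebra.rightCapped (s : ℕ) (y : Graded V ε k) :
    Graded V ε k →ₗ[ℂ] Graded V ε k :=
  DirectSum.toModule ℂ ℕ _ fun m =>
    (if s ≤ 2 * m then (P.partialOrthProd ε k s).flip (P.capTail ε k 0 y)
      else (P.juxt ε k).flip (P.capTail ε k (s - 2 * m) y)) ∘ₗ
      DirectSum.lof ℂ ℕ (fun r => V (r + k) ε) m

theorem PlanarAlgebra.rightCapped_lof_of_le {s m : ℕ} (h : s ≤ 2 * m) (y : Graded V ε k)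
    (a : V (m + k) ε) :
    P.rightCapped ε k s y (DirectSum.lof ℂ ℕ (fun r => V (r + k) ε) m a)
      = P.partialOrthProd ε k s (DirectSum.lof ℂ ℕ (fun r => V (r + k) ε) m a)
        (P.capTail ε k 0 y) := by
  rw [PlanarAlgebra.rightCapped, DirectSum.toModule_lof, if_pos h]
  rfl

theorem PlanarAlgebra.rightCapped_lof_add (m p : ℕ) (y : Graded V ε k) (a : V (m + k) ε) :
    P.rightCapped ε k (2 * m + p) y (DirectSum.lof ℂ ℕ (fun r => V (r + k) ε) m a)
      = P.juxt ε k (DirectSum.lof ℂ ℕ (fun r => V (r + k) ε) m a) (P.capTail ε k p y) := by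
  cases p with
  | zero => rw [Nat.add_zero, P.rightCapped_lof_of_le ε k le_rfl, P.partialOrthProd_two_mul]
  | succ p =>
    rw [PlanarAlgebra.rightCapped, DirectSum.toModule_lof, if_neg (by omega),
      show 2 * m + (p + 1) - 2 * m = p + 1 by omega]
    rfl

/-- For `s < 2 * m` this is the seam computation with `X y` as right factor. For `s ≥ 2 * m` the cap
misses `x` and supplies the next factor of the product acting on `y`. -/
theorem PlanarAlgebra.one_add_capOp_rightCapped (s : ℕ) (y x : Graded V ε k) :
    (1 + P.capOp ε k s) (P.rightCapped ε k (s + 1) y x)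
      = P.rightCapped ε k s y ((1 + P.capOp ε k s) x) := by
  suffices h : (1 + P.capOp ε k s) ∘ₗ P.rightCapped ε k (s + 1) y
      = P.rightCapped ε k s y ∘ₗ (1 + P.capOp ε k s) from LinearMap.congr_fun h x
  refine DirectSum.linearMap_ext ℂ fun m => LinearMap.ext fun a => ?_
  simp only [LinearMap.comp_apply]
  rcases lt_or_ge s (2 * m) with hs | hs
  · have hcap : P.rightCapped ε k s y
          (P.capOp ε k s (DirectSum.lof ℂ ℕ (fun r => V (r + k) ε) m a))
        = P.partialOrthProd ε k s
          (P.capOp ε k s (DirectSum.lof ℂ ℕ (fun r => V (r + k) ε) m a))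
          (P.capTail ε k 0 y) := by
      rcases P.capOp_lof ε k s m a with h | ⟨j, b, rfl, hj, h⟩
      · rw [h, map_zero, map_zero, LinearMap.zero_apply]
      · rw [h, P.rightCapped_lof_of_le ε k hj]
    simp only [LinearMap.add_apply, Module.End.one_apply, map_add]
    rw [hcap, P.rightCapped_lof_of_le ε k hs, P.rightCapped_lof_of_le ε k hs.le]
    generalize P.capTail ε k 0 y = z
    induction z using DirectSum.induction_on with
    | zero => simp
    | of n b => exact P.one_add_capOp_partialOrthProd_lof ε k hs a b
    | add z z' hz hz' =>
      simp only [map_add]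
      rw [add_add_add_comm, hz, hz', add_add_add_comm]
  · obtain ⟨p, rfl⟩ := Nat.exists_eq_add_of_le hs
    rw [LinearMap.add_apply, LinearMap.add_apply, P.capOp_lof_eq_zero ε k (by omega), add_zero,
      Module.End.one_apply, Module.End.one_apply, P.rightCapped_lof_add, Nat.add_assoc,
      P.rightCapped_lof_add, P.capOp_juxt, ← map_add, P.capTail_eq_mul ε k p,
      Module.End.mul_apply]
    rfl

theorem PlanarAlgebra.capProd_rightCapped (s t : ℕ) (y x : Graded V ε k) :
    P.capProd ε k s t (P.rightCapped ε k (s + t) y x)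
      = P.rightCapped ε k s y (P.capProd ε k s t x) := by
  induction t generalizing s with
  | zero => rfl
  | succ t ih =>
    rw [PlanarAlgebra.capProd, Module.End.mul_apply, Module.End.mul_apply,
      ← P.one_add_capOp_rightCapped, ← ih, show s + 1 + t = s + (t + 1) by omega]

theorem PlanarAlgebra.capTail_juxt (x y : Graded V ε k) :
    P.capTail ε k 0 (P.juxt ε k x y)
      = P.orthProd ε k (P.capTail ε k 0 x) (P.capTail ε k 0 y) := by
  have hzero : ∀ x y, P.rightCapped ε k 0 y x = P.orthProd ε k x (P.capTail ε k 0 y) := by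
    intro x y
    induction x using DirectSum.induction_on with
    | zero => simp
    | of m a => exact P.rightCapped_lof_of_le ε k (Nat.zero_le _) y a
    | add x x' hx hx' => rw [map_add, map_add, hx, hx', LinearMap.add_apply]
  induction x using DirectSum.induction_on with
  | zero => simp
  | add x x' hx hx' => simp only [map_add, LinearMap.add_apply, hx, hx']
  | of m a =>
    induction y using DirectSum.induction_on with
    | zero => simp
    | add y y' hy hy' => simp only [map_add, hy, hy']
    | of n b =>
      change P.capTail ε k 0 (P.juxt ε k (DirectSum.lof ℂ ℕ (fun r => V (r + k) ε) m a)
          (DirectSum.lof ℂ ℕ (fun r => V (r + k) ε) n b))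
        = P.orthProd ε k (P.capTail ε k 0 (DirectSum.lof ℂ ℕ (fun r => V (r + k) ε) m a))
          (P.capTail ε k 0 (DirectSum.lof ℂ ℕ (fun r => V (r + k) ε) n b))
      -- At stage `2 * m + 2 * n` no string of `y` is capped yet, so the interpolation equals the
      -- juxtaposition; this many factors also suffice to compute `X` on it and on `x`.
      have h := P.capProd_rightCapped ε k 0 (2 * m + 2 * n)
        (DirectSum.lof ℂ ℕ (fun r => V (r + k) ε) n b)
        (DirectSum.lof ℂ ℕ (fun r => V (r + k) ε) m a)
      rw [Nat.zero_add, P.rightCapped_lof_add, 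
        P.capTail_lof ε k (s := 2 * n) (t := 0) (by omega), hzero,
        ← P.capTail_lof ε k (i := m) (by omega)] at h
      rw [← h, show P.capProd ε k (2 * n) 0 = 1 from rfl, Module.End.one_apply, P.juxt_lof,
        PlanarAlgebra.gradedContract, LinearMap.compr₂_apply,
        P.capTail_lof ε k (t := 2 * m + 2 * n) (by omega)]

end Products

/-! ### Inserting a turn-back of adjacent points -/

/-- The order embedding whose image omits `s` and `s + 1`. -/
def skipTwo (s : ℕ) {n : ℕ} (i : Fin n) : Fin (n + 2) :=
  if (i : ℕ) < s then ⟨i, by omega⟩ else ⟨i + 2, by omega⟩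

theorem skipTwo_val (s : ℕ) {n : ℕ} (i : Fin n) :
    (skipTwo s i : ℕ) = if (i : ℕ) < s then (i : ℕ) else i + 2 := by
  unfold skipTwo
  split_ifs <;> rfl

theorem skipTwo_lt_iff (s : ℕ) {n : ℕ} {i j : Fin n} : skipTwo s i < skipTwo s j ↔ i < j := by
  rw [Fin.lt_def, Fin.lt_def, skipTwo_val, skipTwo_val]
  split_ifs <;> omega

theorem skipTwo_injective (s n : ℕ) : Function.Injective (skipTwo s (n := n)) := by
  intro i j h
  have h' := congrArg Fin.val h
  rw [skipTwo_val, skipTwo_val] at h'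
  apply Fin.ext
  split_ifs at h' <;> omega

theorem skipTwo_cases {s n : ℕ} (hs : s ≤ n) (q : Fin (n + 2)) :
    (∃ i : Fin n, q = skipTwo s i) ∨ q = ⟨s, by omega⟩ ∨ q = ⟨s + 1, by omega⟩ := by
  by_cases h1 : (q : ℕ) = s
  · exact Or.inr (Or.inl (Fin.ext h1))
  by_cases h2 : (q : ℕ) = s + 1
  · exact Or.inr (Or.inr (Fin.ext h2))
  left
  by_cases h3 : (q : ℕ) < s
  · exact ⟨⟨q, by omega⟩, Fin.ext (by rw [skipTwo_val, if_pos h3])⟩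
  · refine ⟨⟨q - 2, by omega⟩, Fin.ext ?_⟩
    rw [skipTwo_val, if_neg (by simp; omega)]
    simp; omega

theorem skipTwo_val_ne (s : ℕ) {n : ℕ} (i : Fin n) :
    (skipTwo s i : ℕ) ≠ s ∧ (skipTwo s i : ℕ) ≠ s + 1 := by
  rw [skipTwo_val]
  split_ifs <;> omega

/-- The boundary points of a rectangle other than the bottom points `s` and `s + 1`. -/
def skipPoint (s : ℕ) {n m : ℕ} : Fin n ⊕ Fin m → Fin (n + 2) ⊕ Fin m :=
  Sum.map (skipTwo s) id

theorem skipPoint_injective (s n m : ℕ) : Function.Injective (skipPoint s (n := n) (m := m)) :=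
  (skipTwo_injective s n).sumMap Function.injective_id

/-- Top points have position at least `n ≥ s`, so they too shift by two. Skipping thus preserves the
cyclic boundary order, and with it the absence of crossings. -/
theorem rectPos_skipPoint {s n m : ℕ} (hs : s ≤ n) (x : Fin n ⊕ Fin m) :
    rectPos (skipPoint s x) = if rectPos x < s then rectPos x else rectPos x + 2 := by
  cases x with
  | inl i => exact skipTwo_val s i
  | inr j =>
    have h : ¬ rectPos (Sum.inr j : Fin n ⊕ Fin m) < s := by
      simp only [rectPos]
      omega
    rw [if_neg h]
    simp only [skipPoint, Sum.map_inr, rectPos, id]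
    omega

theorem rectPos_skipPoint_lt_iff {s n m : ℕ} (hs : s ≤ n) {x y : Fin n ⊕ Fin m} :
    rectPos (skipPoint s x) < rectPos (skipPoint s y) ↔ rectPos x < rectPos y := by
  rw [rectPos_skipPoint hs, rectPos_skipPoint hs]
  split_ifs <;> omega

theorem rectPos_skipPoint_ne {s n m : ℕ} (hs : s ≤ n) (x : Fin n ⊕ Fin m) :
    rectPos (skipPoint s x) ≠ s ∧ rectPos (skipPoint s x) ≠ s + 1 := by
  rw [rectPos_skipPoint hs]
  split_ifs <;> omega

theorem skipPoint_cases {s n m : ℕ} (hs : s ≤ n) (y : Fin (n + 2) ⊕ Fin m) :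
    (∃ x, y = skipPoint s x) ∨ y = Sum.inl ⟨s, by omega⟩ ∨ y = Sum.inl ⟨s + 1, by omega⟩ := by
  cases y with
  | inl q =>
    rcases skipTwo_cases hs q with ⟨i, rfl⟩ | h | h
    · exact Or.inl ⟨Sum.inl i, rfl⟩
    · exact Or.inr (Or.inl (congrArg _ h))
    · exact Or.inr (Or.inr (congrArg _ h))
  | inr j => exact Or.inl ⟨Sum.inr j, rfl⟩

/-- Insert an arc between adjacent bottom points `s` and `s + 1` into a matching. -/
def insertArc {s n m : ℕ} (hs : s ≤ n) (f : Fin n ⊕ Fin m → Fin n ⊕ Fin m) :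
    Fin (n + 2) ⊕ Fin m → Fin (n + 2) ⊕ Fin m
  | Sum.inl q =>
      if h₁ : (q : ℕ) < s then skipPoint s (f (Sum.inl ⟨q, by omega⟩))
      else if h₀ : (q : ℕ) = s then Sum.inl ⟨s + 1, by omega⟩
      else if h₂ : (q : ℕ) = s + 1 then Sum.inl ⟨s, by omega⟩
      else skipPoint s (f (Sum.inl ⟨q - 2, by omega⟩))
  | Sum.inr j => skipPoint s (f (Sum.inr j))

section InsertArc

variable {s n m : ℕ} (hs : s ≤ n)

theorem insertArc_skipPoint (f : Fin n ⊕ Fin m → Fin n ⊕ Fin m) (x : Fin n ⊕ Fin m) :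
    insertArc hs f (skipPoint s x) = skipPoint s (f x) := by
  cases x with
  | inl i =>
    have hne := skipTwo_val_ne s i
    simp only [skipPoint, Sum.map_inl, insertArc]
    have hv := skipTwo_val s i
    by_cases h : (skipTwo s i : ℕ) < s
    · rw [dif_pos h]
      congr 3
      apply Fin.ext
      split_ifs at hv
      · exact hv
      · omega
    · rw [dif_neg h, dif_neg hne.1, dif_neg hne.2]
      congr 3
      apply Fin.ext
      split_ifs at hv
      · omega
      · simp only
        omega
  | inr j => rfl

theorem insertArc_left (f : Fin n ⊕ Fin m → Fin n ⊕ Fin m) :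
    insertArc hs f (Sum.inl ⟨s, by omega⟩) = Sum.inl ⟨s + 1, by omega⟩ := by
  simp [insertArc]

theorem insertArc_right (f : Fin n ⊕ Fin m → Fin n ⊕ Fin m) :
    insertArc hs f (Sum.inl ⟨s + 1, by omega⟩) = Sum.inl ⟨s, by omega⟩ := by
  simp [insertArc]

/-- Insert a turn-back joining the adjacent bottom points `s` and `s + 1` into a diagram. -/
def TLDiagram.insert (D : TLDiagram n m) : TLDiagram (n + 2) m :=
  ⟨insertArc hs D.1, by
    intro y
    rcases skipPoint_cases hs y with ⟨x, rfl⟩ | rfl | rfl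
    · rw [insertArc_skipPoint, insertArc_skipPoint, D.2.1]
    · rw [insertArc_left, insertArc_right]
    · rw [insertArc_right, insertArc_left], by
    intro y
    rcases skipPoint_cases hs y with ⟨x, rfl⟩ | rfl | rfl
    · rw [insertArc_skipPoint]
      exact fun h => D.2.2.1 x (skipPoint_injective _ _ _ h)
    · rw [insertArc_left]
      simp
    · rw [insertArc_right]
      simp, by
    intro x y
    rcases skipPoint_cases hs x with ⟨x, rfl⟩ | rfl | rfl
    · rcases skipPoint_cases hs y with ⟨y, rfl⟩ | rfl | rfl
      · rw [insertArc_skipPoint, insertArc_skipPoint, rectPos_skipPoint_lt_iff hs,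
          rectPos_skipPoint_lt_iff hs, rectPos_skipPoint_lt_iff hs]
        exact D.2.2.2 x y
      · have := rectPos_skipPoint_ne hs (D.1 x)
        rw [insertArc_skipPoint, insertArc_left]
        simp only [rectPos] at *
        omega
      · have := rectPos_skipPoint_ne hs (D.1 x)
        rw [insertArc_skipPoint, insertArc_right]
        simp only [rectPos] at *
        omega
    · rw [insertArc_left]
      simp only [rectPos]
      omega
    · rw [insertArc_right]
      simp only [rectPos]
      omega⟩

theorem TLDiagram.insert_skipPoint (D : TLDiagram n m) (x : Fin n ⊕ Fin m) :
    (D.insert hs).1 (skipPoint s x) = skipPoint s (D.1 x) :=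
  insertArc_skipPoint hs D.1 x

theorem TLDiagram.insert_left (D : TLDiagram n m) :
    (D.insert hs).1 (Sum.inl ⟨s, by omega⟩) = Sum.inl ⟨s + 1, by omega⟩ :=
  insertArc_left hs D.1

theorem TLDiagram.insert_right (D : TLDiagram n m) :
    (D.insert hs).1 (Sum.inl ⟨s + 1, by omega⟩) = Sum.inl ⟨s, by omega⟩ :=
  insertArc_right hs D.1

theorem TLDiagram.insert_injective : Function.Injective (TLDiagram.insert hs (m := m)) := by
  intro D D' h
  refine Subtype.ext (funext fun x => skipPoint_injective s n m ?_)
  rw [← D.insert_skipPoint hs, ← D'.insert_skipPoint hs, h]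

theorem TLDiagram.exists_insert (D : TLDiagram (n + 2) m)
    (h : D.1 (Sum.inl ⟨s, by omega⟩) = Sum.inl ⟨s + 1, by omega⟩) :
    ∃ D' : TLDiagram n m, D'.insert hs = D := by
  have h' : D.1 (Sum.inl ⟨s + 1, by omega⟩) = Sum.inl ⟨s, by omega⟩ := by rw [← h, D.2.1]
  have hne := fun x : Fin n ⊕ Fin m => rectPos_skipPoint_ne hs x
  have hex : ∀ x : Fin n ⊕ Fin m, ∃ z, D.1 (skipPoint s x) = skipPoint s z := by
    intro x
    rcases skipPoint_cases hs (D.1 (skipPoint s x)) with hz | hz | hz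
    · exact hz
    · have := congrArg D.1 hz
      rw [D.2.1, h] at this
      exact absurd (congrArg rectPos this) (hne x).2
    · have := congrArg D.1 hz
      rw [D.2.1, h'] at this
      exact absurd (congrArg rectPos this) (hne x).1
  choose f hf using hex
  have hD : ∃ D' : TLDiagram n m, ∀ x, D.1 (skipPoint s x) = skipPoint s (D'.1 x) := by
    refine ⟨⟨f, fun x => ?_, fun x hx => ?_, fun x y hxy => ?_⟩, hf⟩
    · apply skipPoint_injective s
      rw [← hf, ← hf, D.2.1]
    · apply D.2.2.1 (skipPoint s x)
      rw [hf, hx]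
    · apply D.2.2.2 (skipPoint s x) (skipPoint s y)
      rwa [hf, hf, rectPos_skipPoint_lt_iff hs, rectPos_skipPoint_lt_iff hs,
        rectPos_skipPoint_lt_iff hs]
  obtain ⟨D', hD'⟩ := hD
  refine ⟨D', Subtype.ext (funext fun y => ?_)⟩
  rcases skipPoint_cases hs y with ⟨x, rfl⟩ | rfl | rfl
  · rw [TLDiagram.insert_skipPoint, hD']
  · rw [TLDiagram.insert_left, h]
  · rw [TLDiagram.insert_right, h']

theorem TLDiagram.isEpi_insert (D : TLDiagram n m) : (D.insert hs).IsEpi ↔ D.IsEpi := by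
  refine forall_congr' fun j => ?_
  have h : (D.insert hs).1 (Sum.inr j) = skipPoint s (D.1 (Sum.inr j)) :=
    D.insert_skipPoint hs (Sum.inr j)
  rw [h]
  cases D.1 (Sum.inr j) with
  | inl i => exact ⟨fun _ => ⟨i, rfl⟩, fun _ => ⟨skipTwo s i, rfl⟩⟩
  | inr i => simp [skipPoint]

/-- All right ends of turn-backs on the bottom are at least `s`. -/
def TLDiagram.RightEndsGE {n m : ℕ} (D : TLDiagram n m) (s : ℕ) : Prop :=
  ∀ p q : Fin n, D.1 (Sum.inl q) = Sum.inl p → p < q → s ≤ q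

instance {n m : ℕ} (D : TLDiagram n m) (s : ℕ) : Decidable (D.RightEndsGE s) := by
  unfold TLDiagram.RightEndsGE; infer_instance

theorem TLDiagram.RightEndsGE.mono {D : TLDiagram n m} {s t : ℕ} (h : D.RightEndsGE t)
    (hst : s ≤ t) : D.RightEndsGE s :=
  fun p q hpq hlt => hst.trans (h p q hpq hlt)

theorem TLDiagram.rightEndsGE_one (D : TLDiagram n m) : D.RightEndsGE 1 := by
  intro p q _ hlt
  have := Fin.lt_def.1 hlt
  omega

theorem TLDiagram.insert_skipTwo_eq_inl (D : TLDiagram n m) (p : Fin (n + 2)) (q : Fin n) :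
    (D.insert hs).1 (Sum.inl (skipTwo s q)) = Sum.inl p ↔
      ∃ p', p = skipTwo s p' ∧ D.1 (Sum.inl q) = Sum.inl p' := by
  have h : (D.insert hs).1 (Sum.inl (skipTwo s q)) = skipPoint s (D.1 (Sum.inl q)) :=
    D.insert_skipPoint hs (Sum.inl q)
  rw [h]
  cases D.1 (Sum.inl q) with
  | inl i =>
    simp only [skipPoint, Sum.map_inl, Sum.inl.injEq]
    constructor
    · rintro rfl
      exact ⟨i, rfl, rfl⟩
    · rintro ⟨p', rfl, rfl⟩
      rfl
  | inr i => simp [skipPoint]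

/-- Old right ends below `s` stay in place, those from `s` on move to at least `s + 2`, and the new
one is `s + 1`. -/
theorem TLDiagram.rightEndsGE_insert (D : TLDiagram n m) :
    (D.insert hs).RightEndsGE (s + 1) ↔ D.RightEndsGE s := by
  constructor
  · intro h p q hpq hlt
    have := h (skipTwo s p) (skipTwo s q) ((D.insert_skipTwo_eq_inl hs _ _).2 ⟨p, rfl, hpq⟩)
      ((skipTwo_lt_iff s).2 hlt)
    rw [skipTwo_val] at this
    split_ifs at this <;> omega
  · intro h p q hpq hlt
    rcases skipTwo_cases hs q with ⟨q, rfl⟩ | rfl | rfl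
    · obtain ⟨p, rfl, hp⟩ := (D.insert_skipTwo_eq_inl hs _ _).1 hpq
      have := h p q hp ((skipTwo_lt_iff s).1 hlt)
      rw [skipTwo_val]
      split_ifs <;> omega
    · rw [D.insert_left] at hpq
      cases hpq
      simp at hlt
    · exact le_rfl

/-- Here `s + 1` is a right end. Were its partner `p` less than `s`, the point `s` would lie under
this arc and be joined to some point between `p` and `s`, making `s` a forbidden right end. -/
theorem TLDiagram.eq_of_not_rightEndsGE {D : TLDiagram (n + 2) m} (h : D.RightEndsGE (s + 1))
    (h' : ¬ D.RightEndsGE (s + 2)) :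
    D.1 (Sum.inl ⟨s, by omega⟩) = Sum.inl ⟨s + 1, by omega⟩ := by
  unfold TLDiagram.RightEndsGE at h'
  push Not at h'
  obtain ⟨p, q, hpq, hlt, hq⟩ := h'
  have hq' := h p q hpq hlt
  obtain ⟨q, hqn⟩ := q
  obtain rfl : q = s + 1 := by
    simp only at hq hq'
    omega
  have hp : D.1 (Sum.inl p) = Sum.inl ⟨s + 1, by omega⟩ := by rw [← hpq, D.2.1]
  rw [Fin.lt_def] at hlt
  by_cases hps : (p : ℕ) = s
  · rw [show p = ⟨s, Nat.lt_of_succ_lt hqn⟩ from Fin.ext hps] at hp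
    exact hp
  · have hcross := D.2.2.2 (Sum.inl p) (Sum.inl ⟨s, by omega⟩)
    rw [hp] at hcross
    exfalso
    cases hr : D.1 (Sum.inl ⟨s, by omega⟩) with
    | inr j =>
      rw [hr] at hcross
      simp only [rectPos] at hcross
      simp only at hlt
      omega
    | inl r =>
      rw [hr] at hcross
      simp only [rectPos] at hcross
      simp only at hlt
      have h1 : (r : ℕ) ≠ s := by
        intro h1
        apply D.2.2.1 (Sum.inl ⟨s, by omega⟩)
        rw [hr]
        congr 1
        exact Fin.ext h1
      have h2 : (r : ℕ) ≠ s + 1 := by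
        intro h2
        obtain rfl : r = ⟨s + 1, by omega⟩ := Fin.ext h2
        have := congrArg D.1 hr
        rw [D.2.1, hpq] at this
        exact hps (congrArg Fin.val (Sum.inl.inj this)).symm
      have h3 := h r ⟨s, by omega⟩ hr
      rw [Fin.lt_def] at h3
      simp only at h3
      omega

theorem TLDiagram.not_rightEndsGE_of_eq {D : TLDiagram (n + 2) m}
    (h : D.1 (Sum.inl ⟨s, by omega⟩) = Sum.inl ⟨s + 1, by omega⟩) :
    ¬ D.RightEndsGE (s + 2) := by
  intro h'
  have := h' ⟨s, by omega⟩ ⟨s + 1, by omega⟩ (by rw [← h, D.2.1])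
    (Fin.lt_def.2 (Nat.lt_succ_self s))
  simp at this

/-- The bound on `D` is `s + 1` rather than `s`: a turn-back of `D` ending at `s` would enclose the
inserted arc. This difference separates the recursion for `Y` from that for `X`. -/
theorem TLDiagram.nonNested_insert (D : TLDiagram n m) :
    ((D.insert hs).NonNested ∧ (D.insert hs).RightEndsGE (s + 1)) ↔
      (D.NonNested ∧ D.RightEndsGE (s + 1)) := by
  rw [D.rightEndsGE_insert]
  constructor
  · rintro ⟨h1, h2⟩
    refine ⟨fun p q p' q' hp hp' hlt => ?_, fun p q hpq hlt => ?_⟩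
    · refine h1 (skipTwo s p) (skipTwo s q) (skipTwo s p') (skipTwo s q')
        ((D.insert_skipTwo_eq_inl hs _ _).2 ⟨q, rfl, hp⟩)
        ((D.insert_skipTwo_eq_inl hs _ _).2 ⟨q', rfl, hp'⟩) ?_
      simpa only [skipTwo_lt_iff] using hlt
    · have h3 := h2 p q hpq hlt
      have hqp : D.1 (Sum.inl p) = Sum.inl q := by rw [← hpq, D.2.1]
      have h4 := h1 (skipTwo s p) (skipTwo s q) ⟨s, by omega⟩ ⟨s + 1, by omega⟩
        ((D.insert_skipTwo_eq_inl hs _ _).2 ⟨q, rfl, hqp⟩) (D.insert_left hs)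
      simp only [Fin.lt_def, skipTwo_val] at h4 hlt
      split_ifs at h4 <;> omega
  · rintro ⟨h1, h2⟩
    refine ⟨fun p q p' q' hp hp' hlt => ?_, h2.mono (Nat.le_succ s)⟩
    rcases skipTwo_cases hs p with ⟨p, rfl⟩ | rfl | rfl
    · obtain ⟨q, rfl, hpq⟩ := (D.insert_skipTwo_eq_inl hs _ _).1 hp
      rcases skipTwo_cases hs p' with ⟨p', rfl⟩ | rfl | rfl
      · obtain ⟨q', rfl, hpq'⟩ := (D.insert_skipTwo_eq_inl hs _ _).1 hp'
        refine h1 p q p' q' hpq hpq' ?_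
        simpa only [skipTwo_lt_iff] using hlt
      · rw [D.insert_left] at hp'
        cases hp'
        have hq : D.1 (Sum.inl q) = Sum.inl p := by rw [← hpq, D.2.1]
        simp only [Fin.lt_def, skipTwo_val] at hlt
        have hlt' : (p : ℕ) < s ∧ s ≤ (q : ℕ) := by
          obtain ⟨h5, h6, h7⟩ := hlt
          split_ifs at h5 h7 <;> omega
        have h8 := h2 p q hq (Fin.lt_def.2 (by omega))
        -- The arc from `p` to `q` covers the point `s`, whose partner must then lie under it as
        -- well: to the left it would make `s` a right end, to the right it would give a nested
        -- turn-back.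
        let i : Fin n := ⟨s, by omega⟩
        have hcross := D.2.2.2 (Sum.inl p) (Sum.inl i)
        rw [hpq] at hcross
        cases hr : D.1 (Sum.inl i) with
        | inr j =>
          rw [hr] at hcross
          simp only [rectPos, i] at hcross
          omega
        | inl r =>
          have hir : D.1 (Sum.inl r) = Sum.inl i := by rw [← hr, D.2.1]
          have h9 := h1 p q i r hpq hr
          have h10 := h2 r i hr
          have h11 : r ≠ i := by
            rintro rfl
            exact D.2.2.1 _ hr
          have h12 : (r : ℕ) ≠ (q : ℕ) := by
            intro h12
            obtain rfl : r = q := Fin.ext h12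
            rw [hq] at hir
            have := congrArg Fin.val (Sum.inl.inj hir)
            simp only [i] at this
            omega
          rw [hr] at hcross
          rw [Ne, Fin.ext_iff] at h11
          simp only [rectPos, i, Fin.lt_def] at *
          omega
      · rw [D.insert_right] at hp'
        cases hp'
        simp only [Fin.lt_def] at hlt
        omega
    · rw [D.insert_left] at hp
      cases hp
      simp only [Fin.lt_def] at hlt
      omega
    · rw [D.insert_right] at hp
      cases hp
      simp only [Fin.lt_def] at hlt
      omega

end InsertArc

/-! ### The turn-backs of diagrams with an inserted arc -/

theorem filterMap_finRange_skipTwo {α : Type*} (s : ℕ) {n : ℕ} (hs : s ≤ n)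
    (F : Fin (n + 2) → Option α) (F' : Fin n → Option α) (v : α)
    (hF : ∀ i, F (skipTwo s i) = F' i) (h0 : F ⟨s, by omega⟩ = none)
    (h1 : F ⟨s + 1, by omega⟩ = some v) (hF' : ∀ i : Fin n, (i : ℕ) < s → F' i = none) :
    (List.finRange (n + 2)).filterMap F = v :: (List.finRange n).filterMap F' := by
  induction s generalizing n with
  | zero =>
    rw [List.finRange_succ, List.filterMap_cons_none (show F 0 = none from h0),
      List.filterMap_map, List.finRange_succ,
      List.filterMap_cons_some (show (F ∘ Fin.succ) 0 = some v from h1), List.filterMap_map]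
    congr 2
    funext i
    exact hF i
  | succ s ih =>
    obtain ⟨n, rfl⟩ : ∃ n', n = n' + 1 := ⟨n - 1, by omega⟩
    have e0 : F 0 = none := by
      rw [← hF' 0 (by simp), ← hF 0]
      rfl
    rw [List.finRange_succ, List.filterMap_cons_none e0, List.filterMap_map,
      List.finRange_succ (n := n), List.filterMap_cons_none (hF' 0 (by simp)), List.filterMap_map]
    refine ih (n := n) (by omega) (F ∘ Fin.succ) (F' ∘ Fin.succ) (fun i => ?_) h0 h1
      fun i hi => hF' i.succ (by simpa using hi)
    rw [Function.comp_apply, Function.comp_apply, ← hF]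
    congr 1
    apply Fin.ext
    rw [Fin.val_succ, skipTwo_val, skipTwo_val, Fin.val_succ]
    split_ifs <;> omega

theorem turnBacks_eq_nil {n : ℕ} {g : Fin n → Option (Fin n)}
    (h : ∀ p q, g q = some p → ¬ p < q) : turnBacks g = [] := by
  rw [turnBacks, List.filterMap_eq_nil_iff]
  intro q _
  cases hq : g q with
  | none => rfl
  | some p => exact if_neg (h p q hq)

theorem TLDiagram.bottom_eq_some {n m : ℕ} (D : TLDiagram n m) {p q : Fin n} :
    D.bottom q = some p ↔ D.1 (Sum.inl q) = Sum.inl p := by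
  unfold TLDiagram.bottom
  cases D.1 (Sum.inl q) <;> simp

theorem TLDiagram.IsEpi.turnBacks_top {n m : ℕ} {D : TLDiagram n m} (h : D.IsEpi) :
    turnBacks D.top = [] := by
  refine turnBacks_eq_nil fun p q hq => ?_
  obtain ⟨i, hi⟩ := h q
  rw [TLDiagram.top, hi] at hq
  simp at hq

theorem TLDiagram.IsEpi.layers_eq {n m : ℕ} {D : TLDiagram n m} (h : D.IsEpi) :
    (D.layers : List (Layer V)) = (turnBacks D.bottom).map capAt := by
  rw [TLDiagram.layers, h.turnBacks_top]
  simp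

section InsertArc

variable {s n m : ℕ} (hs : s ≤ n)

theorem TLDiagram.bottom_insert_skipTwo (D : TLDiagram n m) (q : Fin n) :
    (D.insert hs).bottom (skipTwo s q) = (D.bottom q).map (skipTwo s) := by
  ext p
  rw [TLDiagram.bottom_eq_some, D.insert_skipTwo_eq_inl hs]
  simp only [← TLDiagram.bottom_eq_some, Option.map_eq_some_iff]
  exact ⟨fun ⟨p', h1, h2⟩ => ⟨p', h2, h1.symm⟩, fun ⟨p', h1, h2⟩ => ⟨p', h2.symm, h1⟩⟩

/-- The count grows by one exactly when `skipTwo` moves `p` by two, so the entries `p - 2 * card` of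
`turnBacks` are unchanged. -/
theorem TLDiagram.card_rightEnds_insert (D : TLDiagram n m) (p : Fin n) :
    (Finset.univ.filter fun r : Fin (n + 2) =>
        r < skipTwo s p ∧ ∃ t, (D.insert hs).bottom r = some t ∧ t < r).card
      = (Finset.univ.filter fun r : Fin n => r < p ∧ ∃ t, D.bottom r = some t ∧ t < r).card
        + if (p : ℕ) < s then 0 else 1 := by
  have hiff : ∀ r : Fin n, (skipTwo s r < skipTwo s p ∧
      ∃ t, (D.insert hs).bottom (skipTwo s r) = some t ∧ t < skipTwo s r) ↔
      (r < p ∧ ∃ t, D.bottom r = some t ∧ t < r) := by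
    intro r
    rw [skipTwo_lt_iff, D.bottom_insert_skipTwo hs]
    refine and_congr Iff.rfl ⟨?_, ?_⟩
    · rintro ⟨t, ht, hlt⟩
      obtain ⟨t', ht', rfl⟩ := Option.map_eq_some_iff.1 ht
      exact ⟨t', ht', (skipTwo_lt_iff s).1 hlt⟩
    · rintro ⟨t, ht, hlt⟩
      exact ⟨skipTwo s t, by rw [ht]; rfl, (skipTwo_lt_iff s).2 hlt⟩
  have hleft : (D.insert hs).bottom ⟨s, by omega⟩ = some ⟨s + 1, by omega⟩ :=
    (TLDiagram.bottom_eq_some _).2 (D.insert_left hs)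
  have hright : (D.insert hs).bottom ⟨s + 1, by omega⟩ = some ⟨s, by omega⟩ :=
    (TLDiagram.bottom_eq_some _).2 (D.insert_right hs)
  rw [← Finset.card_image_of_injective _ (skipTwo_injective s n)]
  split_ifs with hp
  · rw [Nat.add_zero (Finset.card _)]
    congr 1
    ext y
    simp only [Finset.mem_filter, Finset.mem_univ, true_and, Finset.mem_image]
    constructor
    · intro hy
      rcases skipTwo_cases hs y with ⟨r, rfl⟩ | rfl | rfl
      · exact ⟨r, (hiff r).1 hy, rfl⟩
      · have := hy.1
        rw [Fin.lt_def, skipTwo_val, if_pos hp] at this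
        simp only at this
        omega
      · have := hy.1
        rw [Fin.lt_def, skipTwo_val, if_pos hp] at this
        simp only at this
        omega
    · rintro ⟨r, hr, rfl⟩
      exact (hiff r).2 hr
  · rw [← Finset.card_insert_of_notMem (a := (⟨s + 1, by omega⟩ : Fin (n + 2)))]
    · congr 1
      ext y
      simp only [Finset.mem_filter, Finset.mem_univ, true_and, Finset.mem_insert,
        Finset.mem_image]
      constructor
      · intro hy
        rcases skipTwo_cases hs y with ⟨r, rfl⟩ | rfl | rfl
        · exact Or.inr ⟨r, (hiff r).1 hy, rfl⟩
        · obtain ⟨t, ht, hlt⟩ := hy.2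
          rw [hleft] at ht
          cases ht
          simp [Fin.lt_def] at hlt
        · exact Or.inl rfl
      · rintro (rfl | ⟨r, hr, rfl⟩)
        · refine ⟨?_, _, hright, by simp [Fin.lt_def]⟩
          rw [Fin.lt_def, skipTwo_val, if_neg hp]
          simp only
          omega
        · exact (hiff r).2 hr
    · intro h
      obtain ⟨r, -, hr⟩ := Finset.mem_image.1 h
      exact (skipTwo_val_ne s r).2 (congrArg Fin.val hr)

/-- If no turn-back ends to the left of the inserted one, the inserted one is the first. -/
theorem TLDiagram.turnBacks_insert {D : TLDiagram n m} (hD : D.RightEndsGE s) :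
    turnBacks (D.insert hs).bottom = s :: turnBacks D.bottom := by
  have hleft : (D.insert hs).bottom ⟨s, by omega⟩ = some ⟨s + 1, by omega⟩ :=
    (TLDiagram.bottom_eq_some _).2 (D.insert_left hs)
  have hright : (D.insert hs).bottom ⟨s + 1, by omega⟩ = some ⟨s, by omega⟩ :=
    (TLDiagram.bottom_eq_some _).2 (D.insert_right hs)
  have hcard : ∀ p : Fin n, (p : ℕ) ≤ s → (Finset.univ.filter fun r : Fin n =>
      r < p ∧ ∃ t, D.bottom r = some t ∧ t < r).card = 0 := by
    intro p hp
    rw [Finset.card_eq_zero, Finset.filter_eq_empty_iff]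
    rintro r - ⟨hr, t, ht, hlt⟩
    have := hD t r ((TLDiagram.bottom_eq_some _).1 ht) hlt
    rw [Fin.lt_def] at hr
    omega
  refine filterMap_finRange_skipTwo s hs _ _ s (fun q => ?_) ?_ ?_ fun q hq => ?_
  · rw [D.bottom_insert_skipTwo hs]
    cases hq : D.bottom q with
    | none => rfl
    | some p =>
      simp only [Option.map_some, Option.bind_some, skipTwo_lt_iff]
      split_ifs with hpq
      · rw [D.card_rightEnds_insert hs, skipTwo_val]
        congr 1
        split_ifs <;> omega
      · rfl
  · rw [hleft]
    exact if_neg (by simp [Fin.lt_def])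
  · rw [hright, Option.bind_some, if_pos (by simp [Fin.lt_def])]
    congr 1
    have : (Finset.univ.filter fun r : Fin (n + 2) => r < ⟨s, by omega⟩ ∧
        ∃ t, (D.insert hs).bottom r = some t ∧ t < r).card = 0 := by
      rw [Finset.card_eq_zero, Finset.filter_eq_empty_iff]
      rintro r - ⟨hr, t, ht, hlt⟩
      have := (D.rightEndsGE_insert hs).2 hD t r ((TLDiagram.bottom_eq_some _).1 ht) hlt
      rw [Fin.lt_def] at hr
      simp only at hr
      omega
    rw [this]
    simp
  · cases hp : D.bottom q with
    | none => rfl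
    | some p =>
      refine if_neg fun hlt => ?_
      have := hD p q ((TLDiagram.bottom_eq_some _).1 hp) hlt
      omega

end InsertArc

/-! ### The identity diagram -/

/-- The diagram of `n` vertical strings. -/
def TLDiagram.id (n : ℕ) : TLDiagram n n :=
  ⟨Sum.swap, Sum.swap_swap, by rintro (x | x) <;> simp, by
    rintro (x | x) (y | y) <;> simp only [Sum.swap_inl, Sum.swap_inr, rectPos] <;> omega⟩

theorem TLDiagram.isEpi_id (n : ℕ) : (TLDiagram.id n).IsEpi := fun j => ⟨j, rfl⟩

theorem TLDiagram.bottom_id (n : ℕ) (q : Fin n) : (TLDiagram.id n).bottom q = none := rfl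

theorem TLDiagram.rightEndsGE_id (n s : ℕ) : (TLDiagram.id n).RightEndsGE s := by
  intro p q h
  cases h

theorem TLDiagram.nonNested_id (n : ℕ) : (TLDiagram.id n).NonNested := by
  intro p q p' q' h
  cases h

/-- Right ends at least `n` means no turn-backs on the bottom; all bottom points go to the top, in
order by planarity. -/
theorem TLDiagram.exists_strictMono {n m : ℕ} {D : TLDiagram n m} (hR : D.RightEndsGE n) :
    ∃ σ : Fin n → Fin m, StrictMono σ ∧ ∀ i, D.1 (Sum.inl i) = Sum.inr (σ i) := by
  have hex : ∀ i : Fin n, ∃ j, D.1 (Sum.inl i) = Sum.inr j := by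
    intro i
    cases h : D.1 (Sum.inl i) with
    | inr j => exact ⟨j, rfl⟩
    | inl p =>
      have h' : D.1 (Sum.inl p) = Sum.inl i := by rw [← h, D.2.1]
      rcases lt_trichotomy p i with hlt | rfl | hlt
      · have := hR p i h hlt
        omega
      · exact absurd h (D.2.2.1 _)
      · have := hR i p h' hlt
        omega
  choose σ hσ using hex
  refine ⟨σ, fun i i' hlt => ?_, hσ⟩
  have h1 := D.2.2.2 (Sum.inl i) (Sum.inl i')
  have h2 : σ i ≠ σ i' := by
    intro h
    have := congrArg D.1 ((hσ i).trans ((congrArg Sum.inr h).trans (hσ i').symm))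
    rw [D.2.1, D.2.1] at this
    exact hlt.ne (Sum.inl.inj this)
  rw [hσ, hσ] at h1
  simp only [rectPos, Fin.lt_def] at h1 hlt ⊢
  rw [Ne, Fin.ext_iff] at h2
  omega

theorem TLDiagram.eq_of_isEpi_of_rightEndsGE {n m : ℕ} {D : TLDiagram n m} (hD : D.IsEpi)
    (hR : D.RightEndsGE n) : m = n := by
  obtain ⟨σ, hσ, -⟩ := TLDiagram.exists_strictMono hR
  have := Fintype.card_le_of_injective σ hσ.injective
  simp only [Fintype.card_fin] at this
  exact le_antisymm (D.le_of_isEpi hD) this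

theorem TLDiagram.eq_id_of_rightEndsGE {n : ℕ} {D : TLDiagram n n} (hR : D.RightEndsGE n) :
    D = TLDiagram.id n := by
  obtain ⟨σ, hmono, hσ⟩ := TLDiagram.exists_strictMono hR
  have hid : ∀ i, σ i = i := by
    intro i
    exact le_antisymm (hmono.le_id i) (hmono.id_le i)
  refine Subtype.ext (funext fun x => ?_)
  cases x with
  | inl i => rw [hσ, hid]; rfl
  | inr j =>
    have := congrArg D.1 (hσ j)
    rw [D.2.1, hid] at this
    rw [← this]
    rfl

/-! ### Weighted sums of epi diagrams as operators -/

section WeightedSums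

variable [∀ n ε, AddCommGroup (V n ε)] [∀ n ε, Module ℂ (V n ε)] (P : PlanarAlgebra V)
  (ε : Bool) (k : ℕ)

/-- The bound on right ends makes the inserted turn-back the first cap above the box, so it can be
absorbed into the label. -/
theorem PlanarAlgebra.tlAction_insert {i j s : ℕ} (hs : s ≤ 2 * i)
    {D : TLDiagram (2 * i) (2 * j)} (hD : D.IsEpi) (hR : D.RightEndsGE s) (a : V (i + 1 + k) ε) :
    P.tlAction ε k (i := i + 1) (D.insert hs) a
      = P.tlAction ε k D (P.evalWord (i + k) ε [boxAt 0 a, capAt s]) := by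
  change P.evalWord (j + k) ε ([] ++ boxAt 0 a :: (D.insert hs).layers)
    = P.evalWord (j + k) ε ([] ++ boxAt 0 (P.evalWord (i + k) ε [boxAt 0 a, capAt s]) :: D.layers)
  rw [P.evalWord_box_capAt ε (by omega) s (by omega) a (j + k) [] D.layers 0 ε
    (by simp [regionShading]), hD.layers_eq, ((D.isEpi_insert hs).2 hD).layers_eq,
    TLDiagram.turnBacks_insert hs hR]
  simp

theorem PlanarAlgebra.tlAction_id (i : ℕ) (a : V (i + k) ε) :
    P.tlAction ε k (TLDiagram.id (2 * i)) a = a := by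
  change P.evalWord (i + k) ε ([] ++ boxAt 0 a :: (TLDiagram.id (2 * i)).layers) = a
  rw [(TLDiagram.isEpi_id _).layers_eq, turnBacks_eq_nil]
  · exact P.evalWord_boxAt_zero _ _ a
  · intro p q h
    rw [TLDiagram.bottom_id] at h
    cases h

/-- The operator given by a weighted sum of diagrams. -/
noncomputable def PlanarAlgebra.weightedSum (w : ∀ i j : ℕ, TLDiagram (2 * i) (2 * j) → ℂ) :
    Module.End ℂ (Graded V ε k) :=
  upperTriangular fun j i => ∑ D, w i j D • P.tlAction ε k D

theorem PlanarAlgebra.weightedSum_lof (w : ∀ i j : ℕ, TLDiagram (2 * i) (2 * j) → ℂ) (i : ℕ)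
    (a : V (i + k) ε) :
    P.weightedSum ε k w (DirectSum.lof ℂ ℕ (fun r => V (r + k) ε) i a)
      = ∑ j ∈ Finset.range (i + 1), DirectSum.lof ℂ ℕ (fun r => V (r + k) ε) j
          (∑ D, w i j D • P.tlAction ε k D a) := by
  rw [PlanarAlgebra.weightedSum, upperTriangular, DirectSum.toModule_lof, LinearMap.sum_apply]
  refine Finset.sum_congr rfl fun j _ => ?_
  rw [LinearMap.comp_apply, LinearMap.sum_apply]
  rfl

/-- A sum over diagrams, split according to whether the points `s` and `s + 1` are joined. -/
theorem sum_smul_eq_add_sum_insert {M : Type*} [AddCommGroup M] [Module ℂ M] {s n m : ℕ}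
    (hs : s ≤ n) (w₁ w₂ : TLDiagram (n + 2) m → ℂ) (w₃ : TLDiagram n m → ℂ)
    (F : TLDiagram (n + 2) m → M)
    (h : ∀ D : TLDiagram (n + 2) m, (∀ D' : TLDiagram n m, D'.insert hs ≠ D) → w₁ D = w₂ D)
    (h₂ : ∀ D : TLDiagram n m, w₂ (D.insert hs) = 0)
    (h₃ : ∀ D : TLDiagram n m, w₁ (D.insert hs) = w₃ D) :
    ∑ D, w₁ D • F D = ∑ D, w₂ D • F D + ∑ D, w₃ D • F (D.insert hs) := by
  have hsum : ∑ D, w₃ D • F (D.insert hs) = ∑ D, (w₁ D - w₂ D) • F D := by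
    refine Finset.sum_of_injOn (TLDiagram.insert hs) (TLDiagram.insert_injective hs).injOn
      (fun _ _ => Finset.mem_coe.2 (Finset.mem_univ _)) (fun D _ hD => ?_) fun D _ => ?_
    · rw [h D fun D' hD' => hD ⟨D', by simp, hD'⟩, sub_self, zero_smul]
    · rw [h₂, h₃, sub_zero]
  rw [hsum, ← Finset.sum_add_distrib]
  refine Finset.sum_congr rfl fun D _ => ?_
  rw [← add_smul, add_sub_cancel]

/-- The common form of both recursions: `w₁` and `w₂` differ only on diagrams joining `s` to `s +
1`, and `w₃` weighs what remains after deleting that arc. -/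
theorem PlanarAlgebra.weightedSum_eq_add_mul (s : ℕ)
    (w₁ w₂ w₃ : ∀ i j : ℕ, TLDiagram (2 * i) (2 * j) → ℂ)
    (hsmall : ∀ i j D, 2 * i < s + 2 → w₁ i j D = w₂ i j D)
    (h : ∀ i j (hs : s ≤ 2 * i) (D : TLDiagram (2 * i + 2) (2 * j)),
      (∀ D' : TLDiagram (2 * i) (2 * j), D'.insert hs ≠ D) → w₁ (i + 1) j D = w₂ (i + 1) j D)
    (h₂ : ∀ i j (hs : s ≤ 2 * i) (D : TLDiagram (2 * i) (2 * j)),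
      w₂ (i + 1) j (D.insert hs) = 0)
    (h₃ : ∀ i j (hs : s ≤ 2 * i) (D : TLDiagram (2 * i) (2 * j)),
      w₁ (i + 1) j (D.insert hs) = w₃ i j D)
    (hsupp : ∀ i j (D : TLDiagram (2 * i) (2 * j)), w₃ i j D ≠ 0 → D.IsEpi ∧ D.RightEndsGE s) :
    P.weightedSum ε k w₁ = P.weightedSum ε k w₂ + P.weightedSum ε k w₃ * P.capOp ε k s := by
  refine DirectSum.linearMap_ext ℂ fun i => LinearMap.ext fun a => ?_
  rw [LinearMap.comp_apply, LinearMap.comp_apply, LinearMap.add_apply, Module.End.mul_apply]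
  by_cases hi : 2 * i < s + 2
  · rw [P.capOp_lof_eq_zero ε k hi, map_zero, add_zero, P.weightedSum_lof, P.weightedSum_lof]
    simp only [hsmall i _ _ hi]
  · obtain ⟨i, rfl⟩ : ∃ i', i = i' + 1 := ⟨i - 1, by omega⟩
    have hs : s ≤ 2 * i := by omega
    rw [P.capOp_lof_succ ε k hs]
    simp only [P.weightedSum_lof]
    -- The left side has blocks `j ≤ i + 1`, the capped term only `j ≤ i`; the missing block is zero
    -- because no epi diagram gains points.
    have htop : DirectSum.lof ℂ ℕ (fun r => V (r + k) ε) (i + 1)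
        (∑ D, w₃ i (i + 1) D • P.tlAction ε k D
          (P.evalWord (i + k) ε [boxAt 0 a, capAt s])) = 0 := by
      rw [Finset.sum_eq_zero, map_zero]
      intro D _
      by_cases hD : w₃ i (i + 1) D = 0
      · rw [hD, zero_smul]
      · have := D.le_of_isEpi (hsupp _ _ D hD).1
        omega
    rw [← add_zero (Finset.sum (Finset.range (i + 1)) _), ← htop,
      ← Finset.sum_range_succ (fun j => DirectSum.lof ℂ ℕ (fun r => V (r + k) ε) j
        (∑ D, w₃ i j D • P.tlAction ε k D (P.evalWord (i + k) ε [boxAt 0 a, capAt s]))) (i + 1),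
      ← Finset.sum_add_distrib]
    refine Finset.sum_congr rfl fun j _ => ?_
    rw [← map_add]
    congr 1
    refine (sum_smul_eq_add_sum_insert hs _ _ _ (fun D => P.tlAction ε k (i := i + 1) D a)
      (h i j hs) (h₂ i j hs) (h₃ i j hs)).trans ?_
    congr 1
    refine Finset.sum_congr rfl fun D _ => ?_
    by_cases hD : w₃ i j D = 0
    · rw [hD, zero_smul, zero_smul]
    · obtain ⟨hE, hR⟩ := hsupp _ _ D hD
      rw [P.tlAction_insert ε k hs hE hR]

theorem PlanarAlgebra.weightedSum_lof_eq_self (w : ∀ i j : ℕ, TLDiagram (2 * i) (2 * j) → ℂ)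
    (i : ℕ) (hid : w i i (TLDiagram.id (2 * i)) = 1)
    (hw : ∀ j D, w i j D ≠ 0 → D.IsEpi ∧ D.RightEndsGE (2 * i)) (a : V (i + k) ε) :
    P.weightedSum ε k w (DirectSum.lof ℂ ℕ (fun r => V (r + k) ε) i a)
      = DirectSum.lof ℂ ℕ (fun r => V (r + k) ε) i a := by
  rw [P.weightedSum_lof, Finset.sum_eq_single_of_mem i (Finset.self_mem_range_succ i)]
  · rw [Finset.sum_eq_single_of_mem (TLDiagram.id (2 * i)) (Finset.mem_univ _), hid, one_smul,
      P.tlAction_id]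
    intro D _ hD
    by_cases h : w i i D = 0
    · rw [h, zero_smul]
    · exact absurd (TLDiagram.eq_id_of_rightEndsGE (hw _ D h).2) hD
  · intro j _ hj
    rw [Finset.sum_eq_zero, map_zero]
    intro D _
    by_cases h : w i j D = 0
    · rw [h, zero_smul]
    · have := TLDiagram.eq_of_isEpi_of_rightEndsGE (hw _ D h).1 (hw _ D h).2
      omega

/-! ### The operators `X` and `Y` -/

/-- The indicator function of the epi diagrams with all right ends of turn-backs at least `s`. -/
noncomputable def epiWeight (s i j : ℕ) (D : TLDiagram (2 * i) (2 * j)) : ℂ :=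
  if D.IsEpi ∧ D.RightEndsGE s then 1 else 0

/-- The signed indicator function of the non-nested epi diagrams with all right ends of turn-backs
at least `s`. -/
noncomputable def nonNestedWeight (s i j : ℕ) (D : TLDiagram (2 * i) (2 * j)) : ℂ :=
  if D.IsEpi ∧ D.NonNested ∧ D.RightEndsGE s then (-1) ^ (i - j) else 0

theorem PlanarAlgebra.X_eq_weightedSum : P.X ε k = P.weightedSum ε k (epiWeight 0) := by
  unfold PlanarAlgebra.X PlanarAlgebra.weightedSum
  congr 1
  funext j i
  rw [PlanarAlgebra.xBlock, Finset.sum_filter]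
  refine Finset.sum_congr rfl fun D _ => ?_
  by_cases h : D.IsEpi
  · rw [if_pos h, epiWeight, if_pos ⟨h, D.rightEndsGE_one.mono zero_le_one⟩, one_smul]
  · rw [if_neg h, epiWeight, if_neg fun h' => h h'.1, zero_smul]

theorem PlanarAlgebra.Y_eq_weightedSum : P.Y ε k = P.weightedSum ε k (nonNestedWeight 0) := by
  unfold PlanarAlgebra.Y PlanarAlgebra.weightedSum
  congr 1
  funext j i
  rw [PlanarAlgebra.yBlock, Finset.sum_filter, Finset.smul_sum]
  refine Finset.sum_congr rfl fun D _ => ?_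
  by_cases h : D.IsEpi ∧ D.NonNested
  · rw [if_pos h, nonNestedWeight, if_pos ⟨h.1, h.2, D.rightEndsGE_one.mono zero_le_one⟩]
  · rw [if_neg h, nonNestedWeight, if_neg fun h' => h ⟨h'.1, h'.2.1⟩, zero_smul, smul_zero]

theorem TLDiagram.rightEndsGE_congr {n m s : ℕ} (D : TLDiagram n m) (hn : n < s + 2) :
    D.RightEndsGE (s + 1) ↔ D.RightEndsGE (s + 2) := by
  refine ⟨fun h p q hpq hlt => ?_, fun h => h.mono (Nat.le_succ _)⟩
  have := h p q hpq hlt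
  omega

theorem TLDiagram.rightEndsGE_iff_of_ne_insert {n m s : ℕ} (hs : s ≤ n)
    {D : TLDiagram (n + 2) m} (h : ∀ D' : TLDiagram n m, D'.insert hs ≠ D) :
    D.RightEndsGE (s + 1) ↔ D.RightEndsGE (s + 2) := by
  refine ⟨fun h1 => ?_, fun h1 => h1.mono (Nat.le_succ _)⟩
  by_contra h2
  obtain ⟨D', hD'⟩ := D.exists_insert hs (TLDiagram.eq_of_not_rightEndsGE hs h1 h2)
  exact h D' hD'

theorem PlanarAlgebra.X_eq_capTail : P.X ε k = P.capTail ε k 0 := by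
  rw [P.X_eq_weightedSum]
  refine P.eq_capTail_of_recursion ε k (fun s => P.weightedSum ε k (epiWeight s)) ?_
    (fun s => ?_) fun s i hs a => ?_
  · congr 1
    funext i j D
    simp only [epiWeight, D.rightEndsGE_one, D.rightEndsGE_one.mono zero_le_one]
  · refine P.weightedSum_eq_add_mul ε k s _ _ _ (fun i j D hi => ?_) (fun i j hs D hD => ?_)
      (fun i j hs D => ?_) (fun i j hs D => ?_) fun i j D hD => ?_
    · simp only [epiWeight, D.rightEndsGE_congr hi]
    · unfold epiWeight
      exact if_congr (and_congr Iff.rfl (TLDiagram.rightEndsGE_iff_of_ne_insert hs hD)) rfl rfl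
    · exact if_neg fun h => TLDiagram.not_rightEndsGE_of_eq hs (D.insert_left hs) h.2
    · exact if_congr (and_congr (D.isEpi_insert hs) (D.rightEndsGE_insert hs)) rfl rfl
    · by_contra h
      exact hD (if_neg h)
  · refine P.weightedSum_lof_eq_self ε k _ i
      (if_pos ⟨TLDiagram.isEpi_id _, TLDiagram.rightEndsGE_id _ _⟩) (fun j D hD => ?_) a
    by_contra h
    exact hD (if_neg fun h' => h ⟨h'.1, h'.2.mono hs⟩)

theorem PlanarAlgebra.weightedSum_neg (w : ∀ i j : ℕ, TLDiagram (2 * i) (2 * j) → ℂ) :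
    P.weightedSum ε k (fun i j D => -w i j D) = -P.weightedSum ε k w := by
  refine DirectSum.linearMap_ext ℂ fun i => LinearMap.ext fun a => ?_
  simp only [LinearMap.comp_apply, LinearMap.neg_apply, P.weightedSum_lof, neg_smul,
    Finset.sum_neg_distrib, map_neg]

theorem PlanarAlgebra.Y_mul_capTail : P.Y ε k * P.capTail ε k 0 = 1 := by
  rw [P.Y_eq_weightedSum]
  refine P.mul_capTail_of_recursion ε k (fun s => P.weightedSum ε k (nonNestedWeight s)) ?_
    (fun s => ?_) fun s i hs a => ?_
  · congr 1
    funext i j D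
    simp only [nonNestedWeight, D.rightEndsGE_one, D.rightEndsGE_one.mono zero_le_one]
  · have hneg : -(P.weightedSum ε k (nonNestedWeight (s + 1)) * P.capOp ε k s)
        = P.weightedSum ε k (fun i j D => -nonNestedWeight (s + 1) i j D) * P.capOp ε k s := by
      rw [P.weightedSum_neg]
      rfl
    rw [sub_eq_add_neg, hneg]
    refine P.weightedSum_eq_add_mul ε k s _ _ _ (fun i j D hi => ?_) (fun i j hs D hD => ?_)
      (fun i j hs D => ?_) (fun i j hs D => ?_) fun i j D hD => ?_
    · simp only [nonNestedWeight, D.rightEndsGE_congr hi]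
    · unfold nonNestedWeight
      exact if_congr (and_congr Iff.rfl (and_congr Iff.rfl
        (TLDiagram.rightEndsGE_iff_of_ne_insert hs hD))) rfl rfl
    · exact if_neg fun h => TLDiagram.not_rightEndsGE_of_eq hs (D.insert_left hs) h.2.2
    · have hiff := and_congr (D.isEpi_insert hs) (D.nonNested_insert hs)
      unfold nonNestedWeight
      by_cases h : D.IsEpi ∧ D.NonNested ∧ D.RightEndsGE (s + 1)
      · have := D.le_of_isEpi h.1
        rw [if_pos h]
        refine (if_pos (hiff.2 h)).trans ?_
        -- Truncated subtraction is harmless since `j ≤ i` for epi diagrams; the deleted arc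
        -- accounts for one sign.
        rw [Nat.succ_sub (by omega), pow_succ]
        ring
      · rw [if_neg h, neg_zero]
        exact if_neg fun h' => h (hiff.1 h')
    · by_contra h
      refine hD (neg_eq_zero.2 (if_neg fun h' => h ⟨h'.1, h'.2.2.mono (Nat.le_succ s)⟩))
  · refine P.weightedSum_lof_eq_self ε k _ i ?_ (fun j D hD => ?_) a
    · refine (if_pos ⟨TLDiagram.isEpi_id _, TLDiagram.nonNested_id _,
        TLDiagram.rightEndsGE_id _ _⟩).trans ?_
      rw [Nat.sub_self, pow_zero]
    · by_contra h
      exact hD (if_neg fun h' => h ⟨h'.1, h'.2.2.mono hs⟩)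

end WeightedSums

end PlanarAlg

/-! ### Conclusion -/

theorem mainTheorem10 (V : ℕ → Bool → Type u)
    [∀ n ε, AddCommGroup (V n ε)] [∀ n ε, Module ℂ (V n ε)]
    (P : PlanarAlg.PlanarAlgebra V) (ε : Bool) (k : ℕ) :
    (P.X ε k ∘ₗ P.Y ε k = LinearMap.id ∧ P.Y ε k ∘ₗ P.X ε k = LinearMap.id) ∧
      ∀ a b : PlanarAlg.Graded V ε k,
        P.X ε k (P.juxt ε k a b) = P.orthProd ε k (P.X ε k a) (P.X ε k b) := by
  have hYX : P.Y ε k ∘ₗ P.X ε k = LinearMap.id := by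
    rw [P.X_eq_capTail]
    exact P.Y_mul_capTail ε k
  refine ⟨⟨LinearMap.ext fun x => ?_, hYX⟩, fun a b => ?_⟩
  -- A left inverse of a surjective map is also a right inverse.
  · obtain ⟨y, rfl⟩ := P.capTail_surjective ε k 0 x
    rw [← P.X_eq_capTail, LinearMap.comp_apply, ← LinearMap.comp_apply (P.Y ε k), hYX]
    rfl
  · rw [P.X_eq_capTail]
    exact P.capTail_juxt ε k a b
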